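/- Let $\mathcal{D}$ be a regular ultrafilter on an infinite set $I$, $|I| = \lambda$; that is, there are sets $X_i \in \mathcal{D}$ ($i \in I$) such that each $t \in I$ belongs to only finitely many $X_i$. Then the following are equivalent. 1. $\mathcal{D}$ has $\lambda^+$-treetops: for every $\lambda^+$-saturated model $M$ in a countable language, every tree $(\mathcal{T}_M, \trianglelefteq)$ interpreted in $M$ (with parameters) and every infinite regular cardinal $\gamma < \lambda^+$, each $\trianglelefteq$-increasing sequence $\langle a_i : i < \gamma\rangle$ in the tree $(\mathcal{T}_N, \trianglelefteq)$ interpreted by the same formulas in $N = M^I/\mathcal{D}$ has an upper bound in $\mathcal{T}_N$. Here a tree is a partial order in which the predecessors of each element are linearly ordered. 2. $\mathcal{C}(\mathcal{D})$ contains no symmetric cuts: there is no regular cardinal $\kappa$ with $(\kappa,\kappa) \in \mathcal{C}(\mathcal{D})$, where $\mathcal{C}(\mathcal{D})$ is the set of pairs $(\kappa_1, \kappa_2)$ of regular cardinals $\kappa_1, \kappa_2 \le \lambda$ such that $(\omega,<)^I/\mathcal{D}$ has a $(\kappa_1,\kappa_2)$-cut, i.e. a partition into a lower set $C_1$ and an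 upper set $C_2$ such that $C_1$ has a strictly increasing cofinal sequence of length $\kappa_1$ and $C_2$ has a strictly decreasing coinitial sequence of length $\kappa_2$. 3. $\mathcal{D}$ realizes all $SOP_2$-types over sets of size $\lambda$: for every complete theory $T$ in a countable language, every formula $\psi(x;\bar y)$ with $SOP_2$ in $T$, every $M \models T$ and every $A \subseteq N = M^I/\mathcal{D}$ with $|A| \le \lambda$, each $SOP_2$-type for $\psi$ with parameters in $A$ is realized in $N$. In 3 the notions are as follows. An $SOP_2$-tree for $\psi$ in a model, of shape $(\kappa,\mu)$, is a family $\langle \bar a_\eta : \eta \in {}^{\kappa>}\mu\rangle$ of tuples such that $\{\psi(x;\bar a_\eta), \psi(x;\bar a_\rho)\}$ is inconsistent whenever $\eta, \rho$ are incomparable under initial segment, and $\{\psi(x;\bar a_{\eta\restriction i}) : i < \kappa\}$ is consistent (finitely satisfiable) for each $\eta \in {}^{\kappa}\mu$. The formula $\psi$ has $SOP_2$ in $T$ if every $\aleph_1$-saturated model of $T$ contains an $SOP_2$-tree for $\psi$ of shape $(\omega,2)$. An $SOP_2$-type for $\psi$ in $N = M^I/\mathcal{D}$ is a consistent set of formulas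 $\{\psi(x;\bar b) : \bar b \in B\}$ for which there are sets $P_i$ ($i \in I$) of tuples of $M$, each of them the set of members of an $SOP_2$-tree for $\psi$ in $M$, such that $B$ is contained in the internal set $\prod_i P_i/\mathcal{D}$. Moreover, 3 may be read either with only trees of shape $(\omega,2)$ allowed as the $P_i$, or with trees of arbitrary shapes $(\kappa,\mu)$ (which may vary with $i$) allowed: both versions are equivalent to 1 and 2. -/

import Mathlib

universe u v w

open FirstOrder Filter
open scoped Cardinal Ordinal

/-! ## Regular ultrafilters and ultrapowers -/

/-- An ultrafilter `D` on `I` is regular if it contains a regularizing family of size `|I|`: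
sets `X i ∈ D`, `i : I`, such that each `t : I` lies in only finitely many of them. -/
def Ultrafilter.IsRegular {I : Type u} (D : Ultrafilter I) : Prop :=
  ∃ X : I → Set I, (∀ i, X i ∈ D) ∧ ∀ t, {i | t ∈ X i}.Finite

/-- The ultrapower `M ^ I / D`, an `L`-structure through `FirstOrder.Language.Ultraproduct`. -/
abbrev Ultrapower {I : Type u} (D : Ultrafilter I) (M : Type v) : Type (max u v) :=
  (D : Filter I).Product fun _ => M

/-- The class of a function `I → M` in the ultrapower. -/
def Ultrapower.mk {I : Type u} (D : Ultrafilter I) {M : Type v} (f : I → M) : Ultrapower D M :=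
  Quotient.mk _ f

/-- The diagonal embedding of `M` in its ultrapower. -/
def Ultrapower.diag {I : Type u} (D : Ultrafilter I) {M : Type v} (m : M) : Ultrapower D M :=
  Ultrapower.mk D fun _ => m

/-! ## Cuts -/

/-- The linear order `X` has a `(κ₁, κ₂)`-cut: a partition into a lower set `C₁` and an upper set
`C₂`, where `C₁` has a strictly increasing cofinal sequence of length `κ₁` and `C₂` a strictly
decreasing coinitial sequence of length `κ₂`, and `κ₁`, `κ₂` are (infinite) regular cardinals. -/
def HasCut (X : Type v) [LinearOrder X] (κ₁ κ₂ : Cardinal.{u}) : Prop :=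
  κ₁.IsRegular ∧ κ₂.IsRegular ∧
    ∃ C₁ C₂ : Set X, Disjoint C₁ C₂ ∧ IsLowerSet C₁ ∧ IsUpperSet C₂ ∧
      (∀ x ∈ C₁, ∀ y ∈ C₂, x < y) ∧ C₁ ∪ C₂ = Set.univ ∧
      (∃ a : Set.Iio κ₁.ord → X,
        StrictMono a ∧ (∀ i, a i ∈ C₁) ∧ ∀ x ∈ C₁, ∃ i, x ≤ a i) ∧
      (∃ b : Set.Iio κ₂.ord → X,
        StrictAnti b ∧ (∀ j, b j ∈ C₂) ∧ ∀ y ∈ C₂, ∃ j, b j ≤ y)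

/-- `C(D)`: the pairs of regular cardinals `κ₁, κ₂ ≤ |I|` such that the linear order
`(ω, <) ^ I / D` has a `(κ₁, κ₂)`-cut. -/
def cutSpectrum {I : Type u} (D : Ultrafilter I) : Set (Cardinal.{u} × Cardinal.{u}) :=
  {p | p.1 ≤ #I ∧ p.2 ≤ #I ∧ HasCut (Germ (D : Filter I) ℕ) p.1 p.2}

/-! ## Saturation, interpreted trees, treetops -/

/-- `M` is `κ`-saturated: every set of formulas in one variable with parameters in a set of size
less than `κ` that is finitely satisfiable in `M` is realized in `M`. -/
def IsSaturated (L : FirstOrder.Language.{0, 0}) (M : Type u) [L.Structure M]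
    (κ : Cardinal.{u}) : Prop :=
  ∀ A : Set M, #A < κ → ∀ p : Set (L.Formula (A ⊕ Unit)),
    (∀ s : Finset (L.Formula (A ⊕ Unit)), (s : Set _) ⊆ p →
      ∃ x : M, ∀ φ ∈ s, φ.Realize (Sum.elim (fun a : A => (a : M)) fun _ => x)) →
    ∃ x : M, ∀ φ ∈ p, φ.Realize (Sum.elim (fun a : A => (a : M)) fun _ => x)

/-- The formulas of an interpretation of a partial order on `dim`-tuples, with `npar` parameters:
the domain, the equality of the interpreted structure, and its order. -/
structure OrderInterp (L : FirstOrder.Language.{0, 0}) where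
  npar : ℕ
  dim : ℕ
  dom : L.Formula (Fin npar ⊕ Fin dim)
  eqv : L.Formula (Fin npar ⊕ (Fin dim ⊕ Fin dim))
  le : L.Formula (Fin npar ⊕ (Fin dim ⊕ Fin dim))

namespace OrderInterp

variable {L : FirstOrder.Language.{0, 0}} (F : OrderInterp L) {M : Type u} [L.Structure M]
  (c : Fin F.npar → M)

/-- Tuples representing elements of the interpreted order in `M`, with parameters `c`. -/
def Dom (x : Fin F.dim → M) : Prop := F.dom.Realize (Sum.elim c x)

/-- Two tuples represent the same element. -/
def Eqv (x y : Fin F.dim → M) : Prop := F.eqv.Realize (Sum.elim c (Sum.elim x y))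

/-- The interpreted order, on representatives. -/
def Le (x y : Fin F.dim → M) : Prop := F.le.Realize (Sum.elim c (Sum.elim x y))

/-- With the parameters `c`, the formulas `F` interpret a tree in `M`: `Le` induces a partial order
on the classes of `Eqv` in `Dom` (that is, `Le` is a preorder on `Dom` whose associated equivalence
is `Eqv`), and the predecessors of each element are linearly ordered. -/
structure IsTree : Prop where
  refl : ∀ x, F.Dom c x → F.Le c x x
  trans : ∀ x y z, F.Dom c x → F.Dom c y → F.Dom c z → F.Le c x y → F.Le c y z → F.Le c x z
  eqv_iff : ∀ x y, F.Dom c x → F.Dom c y → (F.Eqv c x y ↔ F.Le c x y ∧ F.Le c y x)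
  linear : ∀ x y z, F.Dom c x → F.Dom c y → F.Dom c z →
    F.Le c x z → F.Le c y z → F.Le c x y ∨ F.Le c y x

end OrderInterp

/-- `D` has `κ`-treetops: `κ` is regular and, whenever a `κ`-saturated model `M` (in a countable
language) interprets a tree, every increasing sequence, of regular length less than `κ`, in the
tree that the same formulas (with the same parameters) interpret in `M ^ I / D` has an upper bound
there. Elements of the tree are given by representatives. -/
def HasTreetops {I : Type u} (D : Ultrafilter I) (κ : Cardinal.{u}) : Prop :=
  κ.IsRegular ∧
    ∀ (L : FirstOrder.Language.{0, 0}) [Countable L.Symbols] (M : Type u) [L.Structure M] [Nonempty M],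
      IsSaturated L M κ →
      ∀ (F : OrderInterp L) (c : Fin F.npar → M), F.IsTree c →
      ∀ γ : Cardinal.{u}, γ.IsRegular → γ < κ →
      ∀ a : Set.Iio γ.ord → Fin F.dim → Ultrapower D M,
        (∀ i, F.Dom (fun k => Ultrapower.diag D (c k)) (a i)) →
        (∀ i j, i < j → F.Le (fun k => Ultrapower.diag D (c k)) (a i) (a j)) →
        ∃ b : Fin F.dim → Ultrapower D M,
          F.Dom (fun k => Ultrapower.diag D (c k)) b ∧
            ∀ i, F.Le (fun k => Ultrapower.diag D (c k)) (a i) b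

/-! ## `SOP₂` -/

/-- The tree of sequences of elements of `μ` of length less than `κ`. -/
structure SeqNode (κ : Ordinal.{v}) (μ : Type w) where
  len : Ordinal.{v}
  len_lt : len < κ
  val : Set.Iio len → μ

namespace SeqNode

variable {κ : Ordinal.{v}} {μ : Type w}

/-- `η` is an initial segment of `ρ`. -/
def IsInitial (η ρ : SeqNode κ μ) : Prop :=
  ∃ h : η.len ≤ ρ.len, ∀ i : Set.Iio η.len, η.val i = ρ.val ⟨i, lt_of_lt_of_le i.2 h⟩

/-- The restriction to `α < κ` of a sequence of length `κ`. -/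
def restrict (β : Set.Iio κ → μ) (α : Set.Iio κ) : SeqNode κ μ :=
  ⟨α, α.2, fun i => β ⟨i, lt_trans (Set.mem_Iio.1 i.2) (Set.mem_Iio.1 α.2)⟩⟩

end SeqNode

section SOP2

variable {L : FirstOrder.Language.{0, 0}} {n : ℕ} {M : Type u} [L.Structure M]

/-- `M ⊨ ψ(x; b)`; formulas `ψ(x; y)` have one variable `x` and a tuple `y` of length `n`. -/
def Holds (ψ : L.Formula (Unit ⊕ Fin n)) (x : M) (b : Fin n → M) : Prop :=
  ψ.Realize (Sum.elim (fun _ => x) b)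

/-- `{ψ(x; b) : b ∈ B}` is a consistent partial `ψ`-type in `M`, i.e. finitely satisfiable. -/
def IsPartialType (ψ : L.Formula (Unit ⊕ Fin n)) (B : Set (Fin n → M)) : Prop :=
  ∀ s : Finset (Fin n → M), (s : Set (Fin n → M)) ⊆ B → ∃ x : M, ∀ b ∈ s, Holds ψ x b

/-- `a` is an `SOP₂`-tree for `ψ` in `M`, indexed by sequences of elements of `μ` of length less
than `κ`: instances at incomparable nodes are inconsistent, instances along a branch are jointly
consistent. -/
def IsSOP2Tree (ψ : L.Formula (Unit ⊕ Fin n)) {κ : Ordinal.{v}} {μ : Type w}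
    (a : SeqNode κ μ → Fin n → M) : Prop :=
  (∀ η ρ : SeqNode κ μ, ¬ η.IsInitial ρ → ¬ ρ.IsInitial η →
    ¬ ∃ x : M, Holds ψ x (a η) ∧ Holds ψ x (a ρ)) ∧
  ∀ β : Set.Iio κ → μ, IsPartialType ψ (Set.range fun α => a (SeqNode.restrict β α))

/-- The set `P` is an `SOP₂`-tree for `ψ` in `M`, of a shape `(κ, μ)` permitted by `S`. -/
def NamesSOP2Tree (S : Ordinal.{u} → Type u → Prop) (ψ : L.Formula (Unit ⊕ Fin n))
    (P : Set (Fin n → M)) : Prop :=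
  ∃ (κ : Ordinal.{u}) (μ : Type u) (a : SeqNode κ μ → Fin n → M),
    S κ μ ∧ IsSOP2Tree ψ a ∧ P = Set.range a

/-- `ψ` has `SOP₂` in `T`: every `ℵ₁`-saturated model of `T` contains an `SOP₂`-tree for `ψ`
indexed by the finite `0`-`1`-sequences. -/
def FormulaHasSOP2 (T : L.Theory) (ψ : L.Formula (Unit ⊕ Fin n)) : Prop :=
  ∀ (M : Type u) [L.Structure M] [Nonempty M], M ⊨ T → IsSaturated L M ℵ₁ →
    ∃ a : SeqNode (ω : Ordinal.{0}) Bool → Fin n → M, IsSOP2Tree ψ a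

/-- The internal subset of `N ^ n`, `N = M ^ I / D`, determined by the sets `P i ⊆ M ^ n`. -/
def internalSet {I : Type v} (D : Ultrafilter I) (P : I → Set (Fin n → M)) :
    Set (Fin n → Ultrapower D M) :=
  {b | ∃ f : Fin n → I → M, (∀ k, b k = Ultrapower.mk D (f k)) ∧
    ∀ᶠ i in (D : Filter I), (fun k => f k i) ∈ P i}

/-- `{ψ(x; b) : b ∈ B}` is an `SOP₂`-type in `M ^ I / D`, with index trees of shapes in `S`: it is
consistent, and its parameters come from an internal set induced by `SOP₂`-trees for `ψ` in the
index models. -/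
def IsSOP2Type {I : Type v} (S : Ordinal.{u} → Type u → Prop) (D : Ultrafilter I)
    (ψ : L.Formula (Unit ⊕ Fin n)) (B : Set (Fin n → Ultrapower D M)) : Prop :=
  IsPartialType ψ B ∧
    ∃ P : I → Set (Fin n → M), (∀ i, NamesSOP2Tree S ψ (P i)) ∧ B ⊆ internalSet D P

end SOP2

/-- `D` realizes all `SOP₂`-types over sets of size (at most) `|I|`, where the trees in the index
models have shapes in `S`: for every complete theory `T` in a countable language, every `ψ` with
`SOP₂` in `T` and every `M ⊨ T`, each `SOP₂`-type for `ψ` over a set `A ⊆ M ^ I / D` with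
`|A| ≤ |I|` is realized in `M ^ I / D`. -/
def RealizesSOP2Types {I : Type u} (S : Ordinal.{u} → Type u → Prop) (D : Ultrafilter I) : Prop :=
  ∀ (L : FirstOrder.Language.{0, 0}) [Countable L.Symbols] (T : L.Theory), T.IsComplete →
  ∀ (n : ℕ) (ψ : L.Formula (Unit ⊕ Fin n)), FormulaHasSOP2.{u} T ψ →
  ∀ (M : Type u) [L.Structure M] [Nonempty M], M ⊨ T →
  ∀ A : Set (Ultrapower D M), #A ≤ #I →
  ∀ B : Set (Fin n → Ultrapower D M), (∀ b ∈ B, ∀ k, b k ∈ A) → IsSOP2Type S D ψ B →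
    ∃ x : Ultrapower D M, ∀ b ∈ B, Holds ψ x b

/-- The shape of the tree of finite `0`-`1`-sequences. -/
def BinaryShape (κ : Ordinal.{u}) (μ : Type u) : Prop := κ = ω ∧ #μ = 2

/-- All shapes. -/
def AnyShape (_κ : Ordinal.{u}) (_μ : Type u) : Prop := True

/-! The absence of symmetric cuts is the hub: it implies the other conditions, and each of them
gives it back.

Suppose there are no symmetric cuts, and take a chain of at most `|I|` elements in an ultraproduct
of trees. It has a maximum or a cofinal sequence of regular length `κ`. By regularity of `D` only
finitely many members of the chain need be visible at an index `t`, and a finite tree is a family of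
nested or disjoint intervals of natural numbers (`TreeLike.exists_intervals`). Along the sequence
the left endpoints increase and the right endpoints decrease in `ω^I/D`. As they do not form a
`(κ,κ)`-cut, some `c` lies strictly inside all the intervals. At each `t` the visible nodes whose
interval contains `c t` are pairwise comparable, and a greatest one bounds the chain
(`exists_upper_bound_of_no_symmetric_cut`). For interpreted trees this gives treetops. For
`SOP₂`-types, consistency makes the parameters a chain of nodes, and a bound places the visible ones
on one branch.

Both converses pass through `BoundsBinaryChains`. Given a symmetric cut `(a_i), (b_i)`, put `h =
b_0` and build by recursion a chain of binary lists `η_i` with exactly `a_i` entries `true` and `h -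
b_i` entries `false`. If a bound of this chain is cut to length below `h`, its number of `true`
entries is at least `a_i` and less than `b_i` for all `i`, so it fills the cut
(`BoundsBinaryChains.no_symmetric_cut`). From condition 3, chains of binary lists are bounded by
realizing the `SOP₂`-types of the formula `y ≤ x` in the binary tree. From treetops, the binary tree
is embedded in a saturated model of its theory, and bounds are pulled back; this needs bounded
height. The saturated model consists of the named elements of an ultrapower whose index set is the
set of assignments of values to names (`exists_saturated`). -/

/-! ## Cofinal sequences and nested intervals -/

/-- A nonempty total preorder has a greatest element or a strictly increasing cofinal sequence of
regular length. -/
theorem exists_cofinal_sequence {J : Type u} [Nonempty J] (r : J → J → Prop)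
    (htot : ∀ i j, r i j ∨ r j i) (htr : ∀ i j k, r i j → r j k → r i k) :
    (∃ m, ∀ j, r j m) ∨ ∃ κ : Cardinal.{u}, κ.IsRegular ∧ κ ≤ #J ∧
      ∃ s : Set.Iio κ.ord → J, (∀ a b, a < b → ¬ r (s b) (s a)) ∧ ∀ j, ∃ a, r j (s a) := by
  classical
  let _ : LinearOrder J := linearOrderOfSTO WellOrderingRel
  have : WellFoundedLT J := ⟨(WellOrderingRel.isWellOrder (α := J)).wf⟩
  -- `S` collects the records of a well-ordering of `J`: elements strictly `r`-above all earlier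
  -- ones. On `S` the well-order and `r` agree, and `S` is `r`-cofinal because the first element
  -- `r`-above `j` is a record.
  let S : Set J := {j | ∀ i < j, ¬ r j i}
  have hcof : ∀ j, ∃ i ∈ S, r j i := by
    intro j
    have hne : {i | r j i}.Nonempty := ⟨j, (htot j j).elim id id⟩
    refine ⟨WellFounded.min wellFounded_lt _ hne, ?_, WellFounded.min_mem wellFounded_lt _ hne⟩
    intro i hi hr
    exact WellFounded.not_lt_min wellFounded_lt {i | r j i}
      (htr _ _ _ (WellFounded.min_mem wellFounded_lt _ hne) hr) hi
  have hS : ∀ i j : S, i < j → ¬ r j i := fun i j hij => j.2 _ hij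
  have hS' : ∀ i j : S, i ≤ j → r i j := by
    intro i j hij
    rcases hij.eq_or_lt with rfl | h
    · exact (htot i i).elim id id
    · exact (htot i j).resolve_right (hS i j h)
  have : Nonempty S := by
    obtain ⟨j⟩ := ‹Nonempty J›
    obtain ⟨i, hi, -⟩ := hcof j
    exact ⟨⟨i, hi⟩⟩
  by_cases htop : ∃ m : S, IsTop m
  · obtain ⟨m, hm⟩ := htop
    left
    refine ⟨m, fun j => ?_⟩
    obtain ⟨i, hi, hr⟩ := hcof j
    exact htr _ _ _ hr (hS' ⟨i, hi⟩ m (hm _))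
  · right
    have : NoTopOrder S := by
      rw [noTopOrder_iff]
      exact fun x hx => htop ⟨x, hx⟩
    refine ⟨Order.cof S, ⟨?_, (Order.cof_ord_cof S).ge⟩,
      (Order.cof_le_cardinalMk S).trans (Cardinal.mk_set_le S), ?_⟩
    · rw [Order.aleph0_le_cof_iff]
      exact Order.one_lt_cof
    obtain ⟨t, ht, ht'⟩ := Ordinal.exists_ord_cof_eq S
    rw [← Ordinal.type_toType (Order.cof S).ord, Ordinal.type_eq] at ht'
    obtain ⟨e⟩ := ht'
    let e' : t ≃o (Order.cof S).ord.ToType := OrderIso.ofRelIsoLT e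
    refine ⟨fun a => ((e'.symm (Ordinal.ToType.mk a) : t) : S), fun a b hab => hS _ _ ?_, fun j => ?_⟩
    · exact (e'.symm.lt_iff_lt.2 (Ordinal.ToType.mk.lt_iff_lt.2 hab) : _)
    · obtain ⟨i, hi, hr⟩ := hcof j
      obtain ⟨k, hk, hik⟩ := ht ⟨i, hi⟩
      refine ⟨Ordinal.ToType.mk.symm (e' ⟨k, hk⟩), htr _ _ _ hr ?_⟩
      simpa using hS' _ _ hik

/-- In a preorder, any two elements below a common element are comparable. -/
def TreeLike (T : Type*) [Preorder T] : Prop :=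
  ∀ x y z : T, x ≤ z → y ≤ z → x ≤ y ∨ y ≤ x

/-- A finite tree can be represented by nested intervals of natural numbers. -/
theorem TreeLike.exists_intervals {T : Type*} [Preorder T] (hT : TreeLike T) (F : Finset T) :
    ∃ l r : T → ℕ, (∀ x ∈ F, l x < r x) ∧
      (∀ x ∈ F, ∀ y ∈ F, x ≤ y → l x ≤ l y ∧ r y ≤ r x) ∧
      (∀ x ∈ F, ∀ y ∈ F, x < y → l x < l y ∧ r y < r x) ∧
      (∀ x ∈ F, ∀ y ∈ F, ¬ x ≤ y → ¬ y ≤ x → r x ≤ l y ∨ r y ≤ l x) := by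
  classical
  induction F using Finset.strongInduction with
  | H F ih =>
  rcases F.eq_empty_or_nonempty with rfl | hne
  · exact ⟨fun _ => 0, fun _ => 0, by simp⟩
  obtain ⟨m, hm⟩ := F.exists_minimal hne
  let F₁ := F.filter fun x => m < x
  let F₂ := F.filter fun x => ¬ m ≤ x
  obtain ⟨l₁, r₁, h1, h2, h3, h4⟩ := ih F₁ (Finset.filter_ssubset.2 ⟨m, hm.1, lt_irrefl m⟩)
  obtain ⟨l₂, r₂, k1, k2, k3, k4⟩ := ih F₂ (Finset.filter_ssubset.2 ⟨m, hm.1, by simp⟩)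
  let N := F₁.sup r₁
  have hN : ∀ x ∈ F₁, r₁ x ≤ N := fun x hx => Finset.le_sup (f := r₁) hx
  have hmin : ∀ x ∈ F, x ≤ m → m ≤ x := fun x hx h => hm.2 hx h
  have cases3 : ∀ x ∈ F, (m ≤ x ∧ x ≤ m) ∨ (m < x ∧ x ∈ F₁) ∨ (¬ m ≤ x ∧ x ∈ F₂) := by
    intro x hx
    by_cases h : m ≤ x
    · by_cases h' : x ≤ m
      · exact Or.inl ⟨h, h'⟩
      · exact Or.inr (Or.inl ⟨lt_of_le_not_ge h h', Finset.mem_filter.2 ⟨hx, lt_of_le_not_ge h h'⟩⟩)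
    · exact Or.inr (Or.inr ⟨h, Finset.mem_filter.2 ⟨hx, h⟩⟩)
  -- If `y ≤ x`, then `y` and `m` both lie below `x`, hence are comparable, and minimality of `m`
  -- gives `m ≤ y` either way.
  have hinc : ∀ x ∈ F, ∀ y ∈ F, m ≤ x → ¬ m ≤ y → ¬ x ≤ y ∧ ¬ y ≤ x := by
    intro x hx y hy hmx hmy
    refine ⟨fun h => hmy (hmx.trans h), fun h => ?_⟩
    rcases hT _ _ _ hmx h with h' | h'
    · exact hmy h'
    · exact hmy (hmin y hy h')
  -- The class of `m` gets `(0, N + 2)`. The intervals above `m` move by 1 and so end by `N + 1`,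
  -- strictly inside; the remaining ones move to the right of `N + 2`.
  let l : T → ℕ := fun x => if m ≤ x then (if x ≤ m then 0 else l₁ x + 1) else l₂ x + (N + 2)
  let r : T → ℕ := fun x => if m ≤ x then (if x ≤ m then N + 2 else r₁ x + 1) else r₂ x + (N + 2)
  have e0 : ∀ x, m ≤ x → x ≤ m → l x = 0 ∧ r x = N + 2 := fun x h h' => by simp [l, r, h, h']
  have e1 : ∀ x, m < x → l x = l₁ x + 1 ∧ r x = r₁ x + 1 := fun x h => by
    simp [l, r, h.le, h.not_ge]
  have e2 : ∀ x, ¬ m ≤ x → l x = l₂ x + (N + 2) ∧ r x = r₂ x + (N + 2) := fun x h => by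
    simp [l, r, h]
  refine ⟨l, r, ?_, ?_, ?_, ?_⟩
  · intro x hx
    rcases cases3 x hx with ⟨h, h'⟩ | ⟨h, h'⟩ | ⟨h, h'⟩
    · have := e0 x h h'; omega
    · have := e1 x h; have := h1 x h'; omega
    · have := e2 x h; have := k1 x h'; omega
  · intro x hx y hy hxy
    rcases cases3 x hx with ⟨h, h'⟩ | ⟨h, h'⟩ | ⟨h, h'⟩ <;>
    rcases cases3 y hy with ⟨g, g'⟩ | ⟨g, g'⟩ | ⟨g, g'⟩
    · have := e0 x h h'; have := e0 y g g'; omega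
    · have := e0 x h h'; have := e1 y g; have := hN y g'; omega
    · exact absurd hxy (hinc x hx y hy h g).1
    · exact absurd (hxy.trans g') h.not_ge
    · have := e1 x h; have := e1 y g; have := h2 x h' y g' hxy; omega
    · exact absurd hxy (hinc x hx y hy h.le g).1
    · exact absurd hxy (hinc y hy x hx g h).2
    · exact absurd hxy (hinc y hy x hx g.le h).2
    · have := e2 x h; have := e2 y g; have := k2 x h' y g' hxy; omega
  · intro x hx y hy hxy
    rcases cases3 x hx with ⟨h, h'⟩ | ⟨h, h'⟩ | ⟨h, h'⟩ <;>
    rcases cases3 y hy with ⟨g, g'⟩ | ⟨g, g'⟩ | ⟨g, g'⟩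
    · exact absurd (g'.trans h) hxy.not_ge
    · have := e0 x h h'; have := e1 y g; have := hN y g'; omega
    · exact absurd hxy.le (hinc x hx y hy h g).1
    · exact absurd (hxy.le.trans g') h.not_ge
    · have := e1 x h; have := e1 y g; have := h3 x h' y g' hxy; omega
    · exact absurd hxy.le (hinc x hx y hy h.le g).1
    · exact absurd hxy.le (hinc y hy x hx g h).2
    · exact absurd hxy.le (hinc y hy x hx g.le h).2
    · have := e2 x h; have := e2 y g; have := k3 x h' y g' hxy; omega
  · intro x hx y hy hxy hyx
    rcases cases3 x hx with ⟨h, h'⟩ | ⟨h, h'⟩ | ⟨h, h'⟩ <;>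
    rcases cases3 y hy with ⟨g, g'⟩ | ⟨g, g'⟩ | ⟨g, g'⟩
    · exact absurd (h'.trans g) hxy
    · exact absurd (h'.trans g.le) hxy
    · have := e0 x h h'; have := e2 y g; omega
    · exact absurd (g'.trans h.le) hyx
    · have := e1 x h; have := e1 y g; have := h4 x h' y g' hxy hyx; omega
    · have := e1 x h; have := e2 y g; have := hN x h'; omega
    · have := e2 x h; have := e0 y g g'; omega
    · have := e2 x h; have := e1 y g; have := hN y g'; omega
    · have := e2 x h; have := e2 y g; have := k4 x h' y g' hxy hyx; omega

/-- Finitely many pairwise comparable elements of a preorder have an upper bound among them. -/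
theorem Finset.exists_upper_bound_of_comparable {T : Type*} [Preorder T] (F : Finset T)
    (hne : F.Nonempty) (h : ∀ x ∈ F, ∀ y ∈ F, x ≤ y ∨ y ≤ x) : ∃ m ∈ F, ∀ x ∈ F, x ≤ m := by
  obtain ⟨m, hm⟩ := F.exists_maximal hne
  exact ⟨m, hm.1, fun x hx => (h x hx m hm.1).elim id fun h' => hm.2 hx h'⟩

/-- If `ω ^ I / D` has no symmetric cuts then every chain of at most `|I|` elements in an ultraproduct
of trees has an upper bound. -/
theorem exists_upper_bound_of_no_symmetric_cut {I : Type u} {D : Ultrafilter I} (hD : D.IsRegular)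
    (hcut : ∀ κ : Cardinal.{u}, (κ, κ) ∉ cutSpectrum D) {T : I → Type w} [∀ t, Preorder (T t)]
    (hT : ∀ t, TreeLike (T t)) {J : Type u} (hJ : #J ≤ #I) [Nonempty J] (f : J → ∀ t, T t)
    (hf : ∀ i j, (∀ᶠ t in (D : Filter I), f i t ≤ f j t) ∨ ∀ᶠ t in (D : Filter I), f j t ≤ f i t) :
    ∃ c : ∀ t, T t, ∀ j, ∀ᶠ t in (D : Filter I), f j t ≤ c t := by
  classical
  rcases exists_cofinal_sequence (fun i j => ∀ᶠ t in (D : Filter I), f i t ≤ f j t) hf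
    (fun i j k hij hjk => by filter_upwards [hij, hjk] with t h h' using h.trans h') with
    ⟨m, hm⟩ | ⟨κ, hκ, hκJ, s, hs, hscof⟩
  · exact ⟨f m, hm⟩
  obtain ⟨X, hX, hXfin⟩ := hD
  obtain ⟨e⟩ := (Cardinal.le_def J I).1 hJ
  have hfin : ∀ t, {j : J | t ∈ X (e j)}.Finite := fun t =>
    (hXfin t).preimage (f := e) e.injective.injOn
  -- The nodes visible at `t`: each member of the chain is visible on a set in `D`, but only
  -- finitely many are visible at any one index.
  let F : ∀ t, Finset (T t) := fun t => (hfin t).toFinset.image fun j => f j t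
  have hF : ∀ j, ∀ᶠ t in (D : Filter I), f j t ∈ F t := by
    intro j
    filter_upwards [hX (e j)] with t ht
    exact Finset.mem_image_of_mem _ ((hfin t).mem_toFinset.2 ht)
  choose l r h1 h2 h3 h4 using fun t => (hT t).exists_intervals (F t)
  let a : Set.Iio κ.ord → Germ (D : Filter I) ℕ := fun i => ((fun t => l t (f (s i) t) : I → ℕ) : Germ _ ℕ)
  let b : Set.Iio κ.ord → Germ (D : Filter I) ℕ := fun i => ((fun t => r t (f (s i) t) : I → ℕ) : Germ _ ℕ)
  have hlt : ∀ i j, i < j → ∀ᶠ t in (D : Filter I), f (s i) t < f (s j) t := by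
    intro i j hij
    have h := hs i j hij
    have h' := (hf (s i) (s j)).resolve_right h
    filter_upwards [h', Ultrafilter.eventually_not.2 h] with t h h' using lt_of_le_not_ge h h'
  have ha : StrictMono a := by
    intro i j hij
    refine Germ.coe_lt.2 ?_
    filter_upwards [hlt i j hij, hF (s i), hF (s j)] with t h hi hj using (h3 t _ hi _ hj h).1
  have hb : StrictAnti b := by
    intro i j hij
    refine Germ.coe_lt.2 ?_
    filter_upwards [hlt i j hij, hF (s i), hF (s j)] with t h hi hj using (h3 t _ hi _ hj h).2
  have hab' : ∀ i, a i < b i := by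
    intro i
    refine Germ.coe_lt.2 ?_
    filter_upwards [hF (s i)] with t h using h1 t _ h
  have hab : ∀ i j, a i < b j := by
    intro i j
    rcases le_total i j with h | h
    · exact (ha.monotone h).trans_lt (hab' j)
    · exact (hab' i).trans_le (hb.antitone h)
  -- Otherwise the downward closure of `a` and the upward closure of `b` exhaust `ω^I/D` and form a
  -- `(κ,κ)`-cut.
  obtain ⟨c, hc⟩ : ∃ c, ∀ i, a i < c ∧ c < b i := by
    by_contra! hno
    refine hcut κ ⟨hκJ.trans hJ, hκJ.trans hJ, hκ, hκ, {x | ∃ i, x ≤ a i}, {y | ∃ i, b i ≤ y},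
      ?_, ?_, ?_, ?_, ?_, ⟨a, ha, fun i => ⟨i, le_rfl⟩, fun x hx => hx⟩,
      ⟨b, hb, fun i => ⟨i, le_rfl⟩, fun x hx => hx⟩⟩
    · rw [Set.disjoint_left]
      rintro x ⟨i, hi⟩ ⟨j, hj⟩
      exact absurd (hj.trans hi) (hab i j).not_ge
    · rintro x y hyx ⟨i, hi⟩
      exact ⟨i, hyx.trans hi⟩
    · rintro x y hxy ⟨i, hi⟩
      exact ⟨i, hi.trans hxy⟩
    · rintro x ⟨i, hi⟩ y ⟨j, hj⟩
      exact (hi.trans_lt (hab i j)).trans_le hj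
    · refine Set.eq_univ_of_forall fun x => ?_
      obtain ⟨i, hi⟩ := hno x
      by_cases h : a i < x
      · exact Or.inr ⟨i, hi h⟩
      · exact Or.inl ⟨i, not_lt.1 h⟩
  induction c using Germ.inductionOn with
  | _ c =>
  obtain ⟨j₀⟩ := ‹Nonempty J›
  -- Incomparable visible nodes have disjoint intervals, so those whose interval contains `c t` form
  -- a finite chain. The index `j₀` only supplies a value when there are none.
  have hex : ∀ t, ∃ d : T t, ∀ x ∈ F t, l t x < c t → c t < r t x → x ≤ d := by
    intro t
    let G := (F t).filter fun x => l t x < c t ∧ c t < r t x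
    by_cases hG : G.Nonempty
    · obtain ⟨m, -, hm⟩ := G.exists_upper_bound_of_comparable hG (by
        intro x hx y hy
        simp only [G, Finset.mem_filter] at hx hy
        by_contra! h
        rcases h4 t x hx.1 y hy.1 h.1 h.2 with h | h <;> omega)
      exact ⟨m, fun x hx h h' => hm x (Finset.mem_filter.2 ⟨hx, h, h'⟩)⟩
    · refine ⟨f j₀ t, fun x hx h h' => absurd ⟨x, Finset.mem_filter.2 ⟨hx, h, h'⟩⟩ hG⟩
  choose d hd using hex
  refine ⟨d, fun j => ?_⟩
  obtain ⟨i, hi⟩ := hscof j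
  filter_upwards [hi, hF (s i), Germ.coe_lt.1 (hc i).1, Germ.coe_lt.1 (hc i).2] with t h h' k k'
  exact h.trans (hd t _ h' k k')

/-! ## Treetops and `SOP₂`-types from the absence of symmetric cuts -/

theorem Ultrapower.exists_rep {I : Type u} {D : Ultrafilter I} {M : Type v} (x : Ultrapower D M) :
    ∃ f : I → M, Ultrapower.mk D f = x :=
  Quotient.exists_rep x

theorem Ultrapower.exists_rep_pi {I : Type u} {D : Ultrafilter I} {M : Type v} {n : ℕ}
    (x : Fin n → Ultrapower D M) : ∃ f : Fin n → I → M, (fun k => Ultrapower.mk D (f k)) = x := by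
  choose f hf using fun k => Ultrapower.exists_rep (x k)
  exact ⟨f, funext hf⟩

/-! ### Łoś's theorem for interpreted orders and instances of `ψ` -/

section Los

variable {L : FirstOrder.Language.{0, 0}} {I : Type u} {D : Ultrafilter I} {M : Type v}
  [L.Structure M] [Nonempty M]

theorem Ultrapower.realize_mk {β : Type*} (φ : L.Formula β) (x : β → I → M) :
    φ.Realize (fun b => Ultrapower.mk D (x b)) ↔
      ∀ᶠ t in (D : Filter I), φ.Realize fun b => x b t :=
  FirstOrder.Language.Ultraproduct.realize_formula_cast φ x

theorem OrderInterp.dom_mk (F : OrderInterp L) (c : Fin F.npar → M) (f : Fin F.dim → I → M) :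
    F.Dom (fun k => Ultrapower.diag D (c k)) (fun k => Ultrapower.mk D (f k)) ↔
      ∀ᶠ t in (D : Filter I), F.Dom c fun k => f k t := by
  unfold OrderInterp.Dom
  convert! Ultrapower.realize_mk F.dom (Sum.elim (fun k _ => c k) f) using 2
  · ext i; cases i <;> rfl
  · ext t; congr! 1; ext i; cases i <;> rfl

theorem OrderInterp.le_mk (F : OrderInterp L) (c : Fin F.npar → M) (f g : Fin F.dim → I → M) :
    F.Le (fun k => Ultrapower.diag D (c k)) (fun k => Ultrapower.mk D (f k))
        (fun k => Ultrapower.mk D (g k)) ↔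
      ∀ᶠ t in (D : Filter I), F.Le c (fun k => f k t) fun k => g k t := by
  unfold OrderInterp.Le
  convert! Ultrapower.realize_mk F.le (Sum.elim (fun k _ => c k) (Sum.elim f g)) using 2
  · ext i; rcases i with i | i | i <;> rfl
  · ext t; congr! 1; ext i; rcases i with i | i | i <;> rfl

theorem holds_mk {n : ℕ} (ψ : L.Formula (Unit ⊕ Fin n)) (x : I → M) (f : Fin n → I → M) :
    Holds ψ (Ultrapower.mk D x) (fun k => Ultrapower.mk D (f k)) ↔
      ∀ᶠ t in (D : Filter I), Holds ψ (x t) fun k => f k t := by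
  unfold Holds
  convert! Ultrapower.realize_mk ψ (Sum.elim (fun _ => x) f) using 2
  · ext i; rcases i with i | i <;> rfl
  · ext t; congr! 1; ext i; rcases i with i | i <;> rfl

end Los

/-- The preorder interpreted by `F`, on representatives. -/
abbrev OrderInterp.IsTree.preorder {L : FirstOrder.Language.{0, 0}} {F : OrderInterp L} {M : Type u}
    [L.Structure M] {c : Fin F.npar → M} (h : F.IsTree c) : Preorder {x // F.Dom c x} where
  le x y := F.Le c x y
  le_refl x := h.refl x x.2
  le_trans x y z := h.trans x y z x.2 y.2 z.2

theorem hasTreetops_of_no_symmetric_cut {I : Type u} [Infinite I] {D : Ultrafilter I}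
    (hD : D.IsRegular) (hcut : ∀ κ : Cardinal.{u}, (κ, κ) ∉ cutSpectrum D) :
    HasTreetops D (Order.succ #I) := by
  classical
  refine ⟨Cardinal.isRegular_succ (Cardinal.aleph0_le_mk I), ?_⟩
  intro L _ M _ _ _ F c hF γ hγ hγI a ha hmono
  choose f hf using fun i => Ultrapower.exists_rep_pi (a i)
  have hdom : ∀ i, ∀ᶠ t in (D : Filter I), F.Dom c fun k => f i k t := fun i => by
    rw [← OrderInterp.dom_mk, hf]; exact ha i
  have hle : ∀ i j, i < j → ∀ᶠ t in (D : Filter I), F.Le c (fun k => f i k t) fun k => f j k t :=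
    fun i j hij => by rw [← OrderInterp.le_mk, hf, hf]; exact hmono i j hij
  let z : Set.Iio γ.ord := ⟨0, hγ.ord_pos⟩
  obtain ⟨t₀, ht₀⟩ := (hdom z).exists
  let _ : Preorder {x // F.Dom c x} := hF.preorder
  -- Representatives may leave the domain on a null set of indices, where a fixed element of the
  -- domain replaces them. Indexing by `γ.ord.ToType` keeps the chain in universe `u`.
  let g : γ.ord.ToType → I → {x // F.Dom c x} := fun i t =>
    if h : F.Dom c (fun k => f (Ordinal.ToType.mk.symm i) k t) then ⟨_, h⟩ else ⟨_, ht₀⟩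
  have hg : ∀ i, ∀ᶠ t in (D : Filter I), (g (Ordinal.ToType.mk i) t : Fin F.dim → M) =
      fun k => f i k t := by
    intro i
    filter_upwards [hdom i] with t ht
    simp [g, ht]
  have hgmono : ∀ i j, i ≤ j → ∀ᶠ t in (D : Filter I), g i t ≤ g j t := by
    intro i j hij
    obtain ⟨i, rfl⟩ := Ordinal.ToType.mk.surjective i
    obtain ⟨j, rfl⟩ := Ordinal.ToType.mk.surjective j
    rcases hij.eq_or_lt with h | h
    · rw [h]; exact Eventually.of_forall fun t => le_rfl
    · filter_upwards [hg i, hg j, hle i j (Ordinal.ToType.mk.lt_iff_lt.1 h)] with t h1 h2 h3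
      change F.Le c _ _
      rwa [h1, h2]
  have : Nonempty γ.ord.ToType := ⟨Ordinal.ToType.mk z⟩
  obtain ⟨b, hb⟩ := exists_upper_bound_of_no_symmetric_cut hD hcut
    (T := fun _ => {x // F.Dom c x}) (fun _ x y z => hF.linear x y z x.2 y.2 z.2)
    (J := γ.ord.ToType) (by simpa using Order.lt_succ_iff.1 hγI) g
    (fun i j => (le_total i j).imp (hgmono i j) (hgmono j i))
  refine ⟨fun k => Ultrapower.mk D fun t => (b t : Fin F.dim → M) k, ?_, fun i => ?_⟩
  · rw [OrderInterp.dom_mk]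
    exact Eventually.of_forall fun t => (b t).2
  · rw [← hf i, OrderInterp.le_mk]
    filter_upwards [hg i, hb (Ordinal.ToType.mk i)] with t h1 h2
    rw [← h1]
    exact h2

/-! ### Trees of sequences and realization of `SOP₂`-types -/

namespace SeqNode

variable {κ : Ordinal.{v}} {μ : Type w}

instance : Preorder (SeqNode κ μ) where
  le := IsInitial
  le_refl η := ⟨le_rfl, fun _ => rfl⟩
  le_trans η ρ σ h h' := ⟨h.1.trans h'.1, fun i => (h.2 i).trans (h'.2 _)⟩

theorem treeLike : TreeLike (SeqNode κ μ) := by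
  rintro x y z ⟨h, hx⟩ ⟨h', hy⟩
  rcases le_total x.len y.len with hl | hl
  · exact Or.inl ⟨hl, fun i => (hx i).trans (hy ⟨i, lt_of_lt_of_le i.2 hl⟩).symm⟩
  · exact Or.inr ⟨hl, fun i => (hy i).trans (hx ⟨i, lt_of_lt_of_le i.2 hl⟩).symm⟩

theorem restrict_eq {β : Set.Iio κ → μ} {η : SeqNode κ μ}
    (h : ∀ i : Set.Iio η.len, β ⟨i, lt_trans (Set.mem_Iio.1 i.2) η.len_lt⟩ = η.val i) :
    restrict β ⟨η.len, η.len_lt⟩ = η := by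
  obtain ⟨len, len_lt, val⟩ := η
  simp only [restrict]
  congr
  exact funext h

end SeqNode

/-- The extra bottom is the value at indices where a representative is not a member of the index
tree; a tree with `κ = 0` has no node to serve as default. -/
theorem TreeLike.withBot {T : Type*} [Preorder T] (h : TreeLike T) : TreeLike (WithBot T) := by
  intro x y z hx hy
  induction x with
  | bot => exact Or.inl bot_le
  | coe x =>
    induction y with
    | bot => exact Or.inr bot_le
    | coe y =>
      induction z with
      | bot => exact absurd hx (by simp)
      | coe z =>
        simp only [WithBot.coe_le_coe] at *
        exact h x y z hx hy

/-- Nodes below `δ` lie on one full branch, obtained by continuing `δ` with a constant value. If `μ`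
is empty there may be no branch, but then the empty sequence is the only possible node and `hex`
suffices. -/
theorem IsSOP2Tree.exists_holds {L : FirstOrder.Language.{0, 0}} {n : ℕ} {M : Type u}
    [L.Structure M] [Nonempty M] {ψ : L.Formula (Unit ⊕ Fin n)} {κ : Ordinal.{v}} {μ : Type w}
    {a : SeqNode κ μ → Fin n → M} (ha : IsSOP2Tree ψ a) {s : Set (SeqNode κ μ)} (hs : s.Finite)
    {δ : SeqNode κ μ} (hδ : ∀ η ∈ s, η ≤ δ) (hex : ∀ η ∈ s, ∃ x, Holds ψ x (a η)) :
    ∃ x, ∀ η ∈ s, Holds ψ x (a η) := by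
  classical
  rcases s.eq_empty_or_nonempty with rfl | ⟨η₀, hη₀⟩
  · exact ⟨Classical.arbitrary M, by simp⟩
  by_cases hμ : Nonempty μ
  · obtain ⟨m⟩ := hμ
    let β : Set.Iio κ → μ := fun i => if h : (i : Ordinal) < δ.len then δ.val ⟨i, h⟩ else m
    obtain ⟨x, hx⟩ := ha.2 β (hs.toFinset.image a) (by
      rintro _ hb
      simp only [Finset.coe_image, Set.Finite.coe_toFinset, Set.mem_image] at hb
      obtain ⟨η, hη, rfl⟩ := hb
      obtain ⟨hl, hv⟩ := hδ η hη
      refine ⟨⟨η.len, η.len_lt⟩, ?_⟩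
      beta_reduce
      rw [SeqNode.restrict_eq]
      intro i
      have : (i : Ordinal) < δ.len := lt_of_lt_of_le i.2 hl
      simp only [β, this, dite_true]
      exact (hv i).symm)
    refine ⟨x, fun η hη => hx _ ?_⟩
    exact Finset.mem_image_of_mem a (hs.mem_toFinset.2 hη)
  · have hlen : ∀ η : SeqNode κ μ, η.len = 0 := by
      intro η
      by_contra h
      exact hμ ⟨η.val ⟨0, pos_iff_ne_zero.2 h⟩⟩
    obtain ⟨x, hx⟩ := hex η₀ hη₀
    refine ⟨x, fun η _ => ?_⟩
    have : η = η₀ := by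
      have h := hlen η
      have h₀ := hlen η₀
      obtain ⟨len, len_lt, val⟩ := η
      obtain ⟨len', len_lt', val'⟩ := η₀
      simp only at h h₀
      subst h h₀
      congr
      funext i
      exact absurd i.2 (by simp)
    rw [this]
    exact hx

/-- Two parameters with a common realization sit at comparable nodes at almost every index, so `B`
is a chain in the ultraproduct of the index trees. Below a bound `d`, the finitely many parameters
visible at `t` lie on one branch and have a common realization `x t`. -/
theorem realizesSOP2Types_of_no_symmetric_cut {I : Type u} [Infinite I] {D : Ultrafilter I}
    (hD : D.IsRegular) (hcut : ∀ κ : Cardinal.{u}, (κ, κ) ∉ cutSpectrum D) :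
    RealizesSOP2Types AnyShape D := by
  classical
  intro L _ T _ n ψ _ M _ _ _ A hA B hBA ⟨hBcon, P, hP, hBP⟩
  rcases B.eq_empty_or_nonempty with rfl | hBne
  · exact ⟨Ultrapower.diag D (Classical.arbitrary M), by simp⟩
  have hBcard : #B ≤ #I := by
    have h1 : #B ≤ #(Fin n → A) := by
      refine Cardinal.mk_le_of_injective (f := fun b k => ⟨b.1 k, hBA b.1 b.2 k⟩) ?_
      intro b b' h
      ext k
      exact congrArg Subtype.val (congrFun h k)
    refine h1.trans ?_
    have h2 : #(Fin n → A) = #A ^ n := by simp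
    rw [h2]
    exact (pow_le_pow_left' hA n).trans (Cardinal.power_nat_le (Cardinal.aleph0_le_mk I))
  have : Nonempty B := hBne.to_subtype
  choose κ μ a _ ha hPa using hP
  choose f hf hfP using fun b : B => hBP b.2
  have hf' : ∀ b : B, (b : Fin n → Ultrapower D M) = fun k => Ultrapower.mk D (f b k) :=
    fun b => funext (hf b)
  let node : B → ∀ t, WithBot (SeqNode (κ t) (μ t)) := fun b t =>
    if h : ∃ η, a t η = fun k => f b k t then (h.choose : SeqNode (κ t) (μ t)) else ⊥
  have hnode : ∀ b, ∀ᶠ t in (D : Filter I), ∃ η : SeqNode (κ t) (μ t),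
      node b t = η ∧ a t η = fun k => f b k t := by
    intro b
    filter_upwards [hfP b] with t ht
    rw [hPa] at ht
    have h : ∃ η, a t η = fun k => f b k t := ht
    exact ⟨h.choose, by simp only [node, h, dite_true], h.choose_spec⟩
  have hcomp : ∀ b b' : B, ∀ᶠ t in (D : Filter I), ∃ x,
      Holds ψ x (fun k => f b k t) ∧ Holds ψ x (fun k => f b' k t) := by
    intro b b'
    obtain ⟨x, hx⟩ := hBcon {b.1, b'.1} (by
      rw [Finset.coe_pair, Set.insert_subset_iff, Set.singleton_subset_iff]
      exact ⟨b.2, b'.2⟩)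
    obtain ⟨g, rfl⟩ := Ultrapower.exists_rep x
    have h1 := hx b (by simp)
    have h2 := hx b' (by simp)
    rw [hf', holds_mk] at h1 h2
    filter_upwards [h1, h2] with t h1 h2 using ⟨g t, h1, h2⟩
  obtain ⟨d, hd⟩ := exists_upper_bound_of_no_symmetric_cut hD hcut
    (T := fun t => WithBot (SeqNode (κ t) (μ t))) (fun t => SeqNode.treeLike.withBot) hBcard node
    (fun b b' => by
      rw [← Ultrafilter.eventually_or]
      filter_upwards [hnode b, hnode b', hcomp b b'] with t ⟨η, h1, h2⟩ ⟨ρ, k1, k2⟩ ⟨x, hx⟩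
      rw [h1, k1, WithBot.coe_le_coe, WithBot.coe_le_coe]
      by_contra! h
      refine (ha t).1 η ρ h.1 h.2 ⟨x, ?_⟩
      rwa [h2, k2])
  obtain ⟨X, hX, hXfin⟩ := hD
  obtain ⟨e⟩ := (Cardinal.le_def B I).1 hBcard
  -- Each of the four premises holds for a given `b` at almost every `t`, so the class of `x`
  -- realizes the type.
  have hex : ∀ t, ∃ x : M, ∀ b : B, t ∈ X (e b) → node b t ≤ d t →
      (∃ x, Holds ψ x (fun k => f b k t)) →
      (∃ η : SeqNode (κ t) (μ t), node b t = η ∧ a t η = fun k => f b k t) →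
      Holds ψ x fun k => f b k t := by
    intro t
    cases hdt : d t with
    | bot =>
      refine ⟨Classical.arbitrary M, fun b _ h _ ⟨η, h1, _⟩ => ?_⟩
      rw [h1] at h
      exact absurd h (by simp)
    | coe δ =>
      let s : Set (SeqNode (κ t) (μ t)) := {η | ∃ b : B, t ∈ X (e b) ∧ node b t = η ∧
        η ≤ δ ∧ ∃ x, Holds ψ x (a t η)}
      have hs : s.Finite := by
        have h1 : {b : B | t ∈ X (e b)}.Finite := (hXfin t).preimage (f := e) e.injective.injOn
        refine Set.Finite.of_finite_image ((h1.image fun b => node b t).subset ?_)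
          (f := fun η => (η : WithBot (SeqNode (κ t) (μ t)))) WithBot.coe_injective.injOn
        rintro _ ⟨η, ⟨b, hb, h, -⟩, rfl⟩
        exact ⟨b, hb, h⟩
      have hsδ : ∀ η ∈ s, η ≤ δ := by
        rintro η ⟨_, _, _, h, _⟩
        exact h
      have hsx : ∀ η ∈ s, ∃ x, Holds ψ x (a t η) := by
        rintro η ⟨_, _, _, _, h⟩
        exact h
      obtain ⟨x, hx⟩ := (ha t).exists_holds hs hsδ hsx
      refine ⟨x, fun b hb h hex ⟨η, h1, h2⟩ => ?_⟩
      rw [← h2]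
      rw [h1, WithBot.coe_le_coe] at h
      exact hx η ⟨b, hb, h1, h, by rwa [h2]⟩
  choose x hx using hex
  refine ⟨Ultrapower.mk D x, fun b hb => ?_⟩
  have hb' : b = _ := hf' ⟨b, hb⟩
  rw [hb', holds_mk]
  filter_upwards [hX (e ⟨b, hb⟩), hd ⟨b, hb⟩, hcomp ⟨b, hb⟩ ⟨b, hb⟩, hnode ⟨b, hb⟩]
    with t h1 h2 ⟨y, h3, _⟩ h4
  exact hx t _ h1 h2 ⟨y, h3⟩ h4

theorem RealizesSOP2Types.mono {I : Type u} {S S' : Ordinal.{u} → Type u → Prop}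
    (h : ∀ κ μ, S κ μ → S' κ μ) {D : Ultrafilter I} (hS' : RealizesSOP2Types S' D) :
    RealizesSOP2Types S D := by
  intro L _ T hT n ψ hψ M _ _ hM A hA B hB hB'
  obtain ⟨hcon, P, hP, hBP⟩ := hB'
  refine hS' L T hT n ψ hψ M hM A hA B hB ⟨hcon, P, fun i => ?_, hBP⟩
  obtain ⟨κ, μ, a, hs, ha⟩ := hP i
  exact ⟨κ, μ, a, h κ μ hs, ha⟩

/-! ## Binary sequences and symmetric cuts -/

/-- Increasing sequences of regular length at most `|I|` in `(2^{<ω})^I / D` that are of internally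
bounded height have upper bounds. -/
def BoundsBinaryChains {I : Type u} (D : Ultrafilter I) : Prop :=
  ∀ γ : Cardinal.{u}, γ.IsRegular → γ ≤ #I → ∀ (f : Set.Iio γ.ord → I → List Bool) (h : I → ℕ),
    (∀ i, ∀ᶠ t in (D : Filter I), (f i t).length ≤ h t) →
    (∀ i j, i < j → ∀ᶠ t in (D : Filter I), f i t <+: f j t) →
    ∃ c : I → List Bool, ∀ i, ∀ᶠ t in (D : Filter I), f i t <+: c t

/-- Passing to a cofinal sequence removes the restriction to regular length; the recursion below
meets arbitrary proper initial segments of `κ`. -/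
theorem BoundsBinaryChains.exists_bound {I : Type u} {D : Ultrafilter I}
    (hB : BoundsBinaryChains D) {J : Type u} [LinearOrder J] (hJ : #J ≤ #I)
    (f : J → I → List Bool) (h : I → ℕ) (hlen : ∀ i, ∀ᶠ t in (D : Filter I), (f i t).length ≤ h t)
    (hf : ∀ i j, i < j → ∀ᶠ t in (D : Filter I), f i t <+: f j t) :
    ∃ c : I → List Bool, ∀ i, ∀ᶠ t in (D : Filter I), f i t <+: c t := by
  rcases isEmpty_or_nonempty J with hJe | hJne
  · exact ⟨fun _ => [], fun i => isEmptyElim i⟩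
  have hf' : ∀ i j, i ≤ j → ∀ᶠ t in (D : Filter I), f i t <+: f j t := by
    intro i j hij
    rcases hij.eq_or_lt with rfl | hij
    · exact Eventually.of_forall fun t => List.prefix_rfl
    · exact hf i j hij
  rcases exists_cofinal_sequence (fun i j : J => i ≤ j) le_total (fun _ _ _ => le_trans) with
    ⟨m, hm⟩ | ⟨κ, hκ, hκJ, s, hs, hscof⟩
  · exact ⟨f m, fun j => hf' j m (hm j)⟩
  · obtain ⟨c, hc⟩ := hB κ hκ (hκJ.trans hJ) (fun i => f (s i)) h (fun i => hlen _)
      (fun i j hij => hf _ _ (not_le.1 (hs i j hij)))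
    refine ⟨c, fun j => ?_⟩
    obtain ⟨i, hi⟩ := hscof j
    filter_upwards [hf' _ _ hi, hc i] with t h1 h2 using h1.trans h2

/-- This truncates a bound `l` so that it satisfies `P` and still extends the members of the chain
that satisfy `P`. -/
theorem List.exists_longest_prefix {α : Type*} (P : List α → Prop) (h0 : P []) (l : List α) :
    ∃ m, P m ∧ ∀ x, x <+: l → P x → x <+: m := by
  induction l using List.reverseRecOn with
  | nil => exact ⟨[], h0, fun x hx _ => hx⟩
  | append_singleton l a ih =>
    by_cases h : P (l ++ [a])
    · exact ⟨_, h, fun x hx _ => hx⟩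
    · obtain ⟨m, hm, hmax⟩ := ih
      refine ⟨m, hm, fun x hx hP => ?_⟩
      rcases List.prefix_concat_iff.1 hx with rfl | hx
      · exact absurd hP h
      · exact hmax x hx hP

theorem BoundsBinaryChains.no_symmetric_cut {I : Type u} {D : Ultrafilter I}
    (hB : BoundsBinaryChains D) (κ : Cardinal.{u}) : (κ, κ) ∉ cutSpectrum D := by
  classical
  rintro ⟨hκI, -, hκ, -, C₁, C₂, -, -, -, hC, hCu, ⟨a₀, ha₀, haC, hacof⟩, b₀, hb₀, hbC, hbcof⟩
  dsimp only at hκI hκ a₀ b₀ ha₀ haC hacof hb₀ hbC hbcof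
  let J := κ.ord.ToType
  have hJ : #J ≤ #I := by simpa [J] using hκI
  choose a ha using fun j : J => Quotient.exists_rep (a₀ (Ordinal.ToType.mk.symm j))
  choose b hb using fun j : J => Quotient.exists_rep (b₀ (Ordinal.ToType.mk.symm j))
  replace ha : ∀ j : J, ((a j : I → ℕ) : Germ (D : Filter I) ℕ) = a₀ (Ordinal.ToType.mk.symm j) := ha
  replace hb : ∀ j : J, ((b j : I → ℕ) : Germ (D : Filter I) ℕ) = b₀ (Ordinal.ToType.mk.symm j) := hb
  have hamono : ∀ i j, i < j → ∀ᶠ t in (D : Filter I), a i t < a j t := fun i j hij => by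
    rw [← Germ.coe_lt, ha, ha]
    exact ha₀ (Ordinal.ToType.mk.symm.lt_iff_lt.2 hij)
  have hbmono : ∀ i j, i < j → ∀ᶠ t in (D : Filter I), b j t < b i t := fun i j hij => by
    rw [← Germ.coe_lt, hb, hb]
    exact hb₀ (Ordinal.ToType.mk.symm.lt_iff_lt.2 hij)
  have hab : ∀ i j, ∀ᶠ t in (D : Filter I), a i t < b j t := fun i j => by
    rw [← Germ.coe_lt, ha, hb]
    exact hC _ (haC _) _ (hbC _)
  let z : J := Ordinal.ToType.mk ⟨0, hκ.ord_pos⟩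
  have hz : ∀ j, z ≤ j := by
    intro j
    obtain ⟨j, rfl⟩ := Ordinal.ToType.mk.surjective j
    exact Ordinal.ToType.mk.le_iff_le.2 (Subtype.coe_le_coe.1 (zero_le (a := (j : Ordinal))))
  let h : I → ℕ := b z
  have hbh : ∀ j, ∀ᶠ t in (D : Filter I), b j t ≤ h t := by
    intro j
    rcases (hz j).eq_or_lt with rfl | hj
    · exact Eventually.of_forall fun t => le_rfl
    · filter_upwards [hbmono _ _ hj] with t ht using ht.le
  -- The entries `true` count the steps up from 0 to `a i`, and the entries `false` the steps down
  -- from `h` to `b i`. Since `a i < b i`, the length stays below `h`.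
  let Good : J → (I → List Bool) → Prop := fun i e => ∀ᶠ t in (D : Filter I),
    (e t).count true = a i t ∧ (e t).count false + b i t = h t
  have hlength : ∀ i e, Good i e → ∀ᶠ t in (D : Filter I), (e t).length < h t := by
    intro i e he
    filter_upwards [he, hab i i] with t ht ht'
    have := List.count_true_add_count_false (e t)
    omega
  have hstep : ∀ (i : J) (e : ∀ j, j < i → I → List Bool), (∀ j hj, Good j (e j hj)) →
      (∀ j j' hj hj', j < j' → ∀ᶠ t in (D : Filter I), e j hj t <+: e j' hj' t) →
      ∃ e', Good i e' ∧ ∀ j hj, ∀ᶠ t in (D : Filter I), e j hj t <+: e' t := by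
    intro i e he hmono
    obtain ⟨c, hc⟩ := hB.exists_bound (J := {j // j < i}) ((Cardinal.mk_subtype_le _).trans hJ)
      (fun j => e j j.2) h (fun j => (hlength _ _ (he j j.2)).mono fun t => le_of_lt)
      (fun j j' hjj' => hmono _ _ _ _ hjj')
    -- The bound `c t` may exceed the two counts allowed at stage `i`. Cut within them, it still
    -- extends every earlier list, and padding then makes the counts exact.
    choose m hm hmax using fun t => List.exists_longest_prefix
      (fun l => l.count true ≤ a i t ∧ l.count false ≤ h t - b i t) (by simp) (c t)
    refine ⟨fun t => m t ++ (List.replicate (a i t - (m t).count true) true ++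
      List.replicate (h t - b i t - (m t).count false) false), ?_, fun j hj => ?_⟩
    · filter_upwards [hbh i] with t ht
      have := hm t
      simp only [List.count_append, List.count_replicate, beq_self_eq_true, if_true]
      simp
      omega
    · filter_upwards [hc ⟨j, hj⟩, he j hj, hamono j i hj, hbmono j i hj, hbh j] with t h1 h2 h3 h4 h5
      exact (hmax t _ h1 (by omega)).trans (List.prefix_append _ _)
  -- The default value is never taken along the recursion: `hstep` provides an extension at every
  -- stage.
  let step : ∀ i : J, (∀ j, j < i → I → List Bool) → I → List Bool := fun i prev =>
    if hex : ∃ e', Good i e' ∧ ∀ j hj, ∀ᶠ t in (D : Filter I), prev j hj t <+: e' t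
    then hex.choose else fun _ => []
  let η : J → I → List Bool := (wellFounded_lt (α := J)).fix step
  have hη : ∀ i, Good i (η i) ∧ ∀ j, j < i → ∀ᶠ t in (D : Filter I), η j t <+: η i t := by
    intro i
    induction i using WellFoundedLT.induction with
    | _ i ih =>
    have hex := hstep i (fun j _ => η j) (fun j hj => (ih j hj).1)
      (fun j j' _ hj' hjj' => (ih j' hj').2 j hjj')
    have heq : η i = hex.choose := by
      simp only [η]
      rw [WellFounded.fix_eq]
      exact dif_pos hex
    rw [heq]
    exact hex.choose_spec
  obtain ⟨c, hc⟩ := hB.exists_bound hJ η h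
    (fun j => (hlength _ _ (hη j).1).mono fun t => le_of_lt) (fun i j hij => (hη j).2 i hij)
  -- The alternative `l = []` only covers indices with `h t = 0`, which form a null set.
  choose m hm hmax using fun t => List.exists_longest_prefix
    (fun l => l = [] ∨ l.length < h t) (by simp) (c t)
  let x : I → ℕ := fun t => (m t).count true
  have hx : ∀ j, ∀ᶠ t in (D : Filter I), a j t ≤ x t ∧ x t < b j t := by
    -- As `m t` extends `η j t`, it has at least `a j t` entries `true` and `h t - b j t` entries
    -- `false`; length below `h t` leaves fewer than `b j t` entries `true`.
    intro j
    filter_upwards [hc j, (hη j).1, hlength _ _ (hη j).1] with t h1 h2 h3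
    have h4 := hmax t _ h1 (Or.inr h3)
    have h5 := h4.sublist.count_le true
    have h6 := h4.sublist.count_le false
    have h7 := List.count_true_add_count_false (m t)
    have h8 : (m t).length < h t := by
      rcases hm t with h | h
      · rw [h]; simp; omega
      · exact h
    simp only [x]
    omega
  have hxu : ((x : I → ℕ) : Germ (D : Filter I) ℕ) ∈ C₁ ∪ C₂ := by rw [hCu]; trivial
  rcases hxu with hx1 | hx2
  · obtain ⟨i, hi⟩ := hacof _ hx1
    -- The lower bound `a j t ≤ x t` is not strict, so the next term of `a₀` is needed to exceed `a₀
    -- i`; on the upper side `x` is already strictly below.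
    have hsucc : Order.succ (i : Ordinal) < κ.ord :=
      (Cardinal.isSuccLimit_ord hκ.aleph0_le).succ_lt i.2
    have h1 : a₀ i < a₀ ⟨_, hsucc⟩ := ha₀ (Order.lt_succ (i : Ordinal))
    have h2 : a₀ ⟨_, hsucc⟩ ≤ ((x : I → ℕ) : Germ (D : Filter I) ℕ) := by
      have := ha (Ordinal.ToType.mk ⟨_, hsucc⟩)
      rw [OrderIso.symm_apply_apply] at this
      rw [← this]
      exact Germ.coe_le.2 ((hx _).mono fun t => And.left)
    exact absurd (h1.trans_le (h2.trans hi)) (lt_irrefl _)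
  · obtain ⟨i, hi⟩ := hbcof _ hx2
    have h2 : ((x : I → ℕ) : Germ (D : Filter I) ℕ) < b₀ i := by
      have := hb (Ordinal.ToType.mk i)
      rw [OrderIso.symm_apply_apply] at this
      rw [← this]
      exact Germ.coe_lt.2 ((hx _).mono fun t => And.right)
    exact absurd (h2.trans_le hi) (lt_irrefl _)

/-! ## The theory of the binary tree -/

/-- A tree order in which every element has two extensions without a common upper bound. -/
structure IsSplittingTree {M : Type*} (r : M → M → Prop) : Prop where
  refl : ∀ x, r x x
  trans : ∀ x y z, r x y → r y z → r x z
  linear : ∀ x y z, r x z → r y z → r x y ∨ r y x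
  split : ∀ x, ∃ y z, r x y ∧ r x z ∧ ¬ ∃ w, r y w ∧ r z w

namespace IsSplittingTree

variable {M : Type*} {r : M → M → Prop}

theorem exists_successor (h : IsSplittingTree r) : ∃ s : M → Bool → M, (∀ x b, r x (s x b)) ∧
    ∀ x b c, b ≠ c → ¬ ∃ w, r (s x b) w ∧ r (s x c) w := by
  choose y z hy hz hyz using h.split
  refine ⟨fun x b => bif b then y x else z x, fun x b => ?_, fun x b c hbc => ?_⟩
  · cases b
    · exact hz x
    · exact hy x
  · rintro ⟨w, hw⟩
    cases b <;> cases c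
    · exact hbc rfl
    · exact hyz x ⟨w, hw.2, hw.1⟩
    · exact hyz x ⟨w, hw⟩
    · exact hbc rfl

/-- The binary tree embeds in every splitting tree. -/
theorem exists_binary_subtree [Nonempty M] (h : IsSplittingTree r) : ∃ g : List Bool → M,
    (∀ x y, x <+: y → r (g x) (g y)) ∧
      ∀ x y, ¬ x <+: y → ¬ y <+: x → ¬ ∃ w, r (g x) w ∧ r (g y) w := by
  obtain ⟨s, hs, hs'⟩ := h.exists_successor
  have hfold : ∀ (l : List Bool) x, r x (l.foldl s x) := by
    intro l
    induction l with
    | nil => exact h.refl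
    | cons b l ih => exact fun x => h.trans _ _ _ (hs x b) (ih _)
  -- `foldl` reads a list from its head, so appending entries climbs further. At the first
  -- disagreement the two paths pass through successors without a common upper bound.
  refine ⟨fun l => l.foldl s (Classical.arbitrary M), ?_, ?_⟩
  · rintro x _ ⟨l, rfl⟩
    beta_reduce
    rw [List.foldl_append]
    exact hfold _ _
  · intro x
    generalize Classical.arbitrary M = m
    induction x generalizing m with
    | nil => intro y hy; exact absurd List.nil_prefix hy
    | cons b x ih =>
      intro y hxy hyx
      cases y with
      | nil => exact absurd List.nil_prefix hyx
      | cons c y =>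
        by_cases hbc : b = c
        · subst hbc
          rw [List.prefix_cons_inj] at hxy hyx
          exact ih (s m b) y hxy hyx
        · rintro ⟨w, h1, h2⟩
          exact hs' m b c hbc ⟨w, h.trans _ _ _ (hfold x _) h1, h.trans _ _ _ (hfold y _) h2⟩

end IsSplittingTree

theorem isSplittingTree_prefix :
    IsSplittingTree fun x y : ULift.{u} (List Bool) => x.down <+: y.down where
  refl _ := List.prefix_rfl
  trans _ _ _ := List.IsPrefix.trans
  linear _ _ _ := List.prefix_or_prefix_of_prefix
  split x := by
    refine ⟨⟨x.down ++ [true]⟩, ⟨x.down ++ [false]⟩, List.prefix_append _ _,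
      List.prefix_append _ _, ?_⟩
    rintro ⟨w, h1, h2⟩
    have h := List.prefix_of_prefix_length_le h1 h2 (by simp)
    rw [List.prefix_append_right_inj] at h
    simp at h

open FirstOrder.Language in
/-- The sentence axiomatizing splitting trees. -/
def splittingTreeSentence : Language.order.Sentence :=
  (leSymb (L := Language.order)).reflexive ⊓ (leSymb (L := Language.order)).transitive ⊓
    (∀' ∀' ∀' ((leSymb (L := Language.order)).boundedFormula₂ (&0) (&2) ⟹
      (leSymb (L := Language.order)).boundedFormula₂ (&1) (&2) ⟹
      ((leSymb (L := Language.order)).boundedFormula₂ (&0) (&1) ⊔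
        (leSymb (L := Language.order)).boundedFormula₂ (&1) (&0)))) ⊓
    (∀' ∃' ∃' ((leSymb (L := Language.order)).boundedFormula₂ (&0) (&1) ⊓
      ((leSymb (L := Language.order)).boundedFormula₂ (&0) (&2) ⊓
        ∼ (∃' ((leSymb (L := Language.order)).boundedFormula₂ (&1) (&3) ⊓
          (leSymb (L := Language.order)).boundedFormula₂ (&2) (&3))))))

/-- The interpretation of the order symbol. -/
abbrev symbLe {M : Type*} [Language.order.Structure M] (x y : M) : Prop :=
  Language.Structure.RelMap (Language.leSymb (L := Language.order)) ![x, y]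

-- This one sentence is all that is used of the theory of the binary tree: in any model of it,
-- `exists_binary_subtree` finds a copy of `List Bool`.
open FirstOrder.Language in
theorem realize_splittingTreeSentence {M : Type*} [Language.order.Structure M] :
    M ⊨ splittingTreeSentence ↔ IsSplittingTree fun x y : M => symbLe x y := by
  unfold splittingTreeSentence
  simp only [Sentence.Realize, Formula.realize_inf]
  have h1 := @Relations.realize_reflexive Language.order M _ leSymb
  have h2 := @Relations.realize_transitive Language.order M _ leSymb
  simp only [Sentence.Realize] at h1 h2
  rw [h1, h2]
  simp only [Formula.Realize, BoundedFormula.realize_all, BoundedFormula.realize_imp,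
    BoundedFormula.realize_sup, BoundedFormula.realize_inf, BoundedFormula.realize_ex,
    BoundedFormula.realize_not, BoundedFormula.realize_rel₂]
  constructor
  · rintro ⟨⟨⟨h1, h2⟩, h3⟩, h4⟩
    exact ⟨h1.refl, h2.trans, h3, h4⟩
  · rintro ⟨h1, h2, h3, h4⟩
    exact ⟨⟨⟨⟨h1⟩, ⟨h2⟩⟩, h3⟩, h4⟩

/-- The tree of finite binary sequences as a first-order structure. -/
instance binaryTreeStructure : Language.order.Structure (ULift.{u} (List Bool)) where
  funMap f := nomatch f
  RelMap {n} _ v := match n, v with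
    | 2, v => (v 0).down <+: (v 1).down
    | _, _ => False

theorem binaryTree_realize : ULift.{u} (List Bool) ⊨ splittingTreeSentence :=
  realize_splittingTreeSentence.2 isSplittingTree_prefix

/-! ### Nodes of shape `(ω, 2)` as finite binary lists -/

namespace SeqNode

variable {μ : Type w}

/-- The length of a node of finite level. -/
noncomputable def natLen (η : SeqNode (ω : Ordinal.{v}) μ) : ℕ :=
  (Ordinal.lt_omega0.1 η.len_lt).choose

theorem natLen_spec (η : SeqNode (ω : Ordinal.{v}) μ) : η.len = η.natLen :=
  (Ordinal.lt_omega0.1 η.len_lt).choose_spec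

/-- The finite binary sequence represented by a node. -/
noncomputable def toList (e : μ ≃ Bool) (η : SeqNode (ω : Ordinal.{v}) μ) : List Bool :=
  List.ofFn fun i : Fin η.natLen => e (η.val ⟨(i : ℕ), by
    rw [Set.mem_Iio, natLen_spec η]; exact_mod_cast i.2⟩)

theorem toList_prefix (e : μ ≃ Bool) (η ρ : SeqNode (ω : Ordinal.{v}) μ) :
    η.toList e <+: ρ.toList e ↔ η ≤ ρ := by
  rw [List.prefix_iff_getElem]
  simp only [toList, List.length_ofFn, List.getElem_ofFn, EmbeddingLike.apply_eq_iff_eq]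
  constructor
  · rintro ⟨h, h'⟩
    refine ⟨?_, ?_⟩
    · rw [natLen_spec η, natLen_spec ρ]
      exact_mod_cast h
    · rintro ⟨i, hi⟩
      rw [Set.mem_Iio] at hi
      obtain ⟨k, rfl⟩ := Ordinal.lt_omega0.1 (hi.trans η.len_lt)
      refine h' k ?_
      rw [natLen_spec η] at hi
      exact_mod_cast hi
  · rintro ⟨h, h'⟩
    refine ⟨?_, fun i hi => h' _⟩
    rw [natLen_spec η, natLen_spec ρ] at h
    exact_mod_cast h

/-- Surjectivity makes the `SOP₂`-tree exhaust the index model, so that every element of the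
ultrapower is an admissible parameter. -/
theorem toList_surjective (e : μ ≃ Bool) :
    Function.Surjective (toList e : SeqNode (ω : Ordinal.{v}) μ → List Bool) := by
  intro l
  let η : SeqNode (ω : Ordinal.{v}) μ := ⟨l.length, Ordinal.natCast_lt_omega0 _, fun i =>
    e.symm (l.getD (Ordinal.lt_omega0.1 (lt_trans (Set.mem_Iio.1 i.2)
      (Ordinal.natCast_lt_omega0 l.length))).choose false)⟩
  have hlen : η.natLen = l.length := by
    have h : (l.length : Ordinal.{v}) = η.natLen := natLen_spec η
    exact_mod_cast h.symm
  refine ⟨η, List.ext_getElem (by simp [toList, hlen]) fun i h1 h2 => ?_⟩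
  have hi : ((i : ℕ) : Ordinal.{v}) < ω := Ordinal.natCast_lt_omega0 i
  have hc : (Ordinal.lt_omega0.1 hi).choose = i := by
    have := (Ordinal.lt_omega0.1 hi).choose_spec
    exact_mod_cast this.symm
  simp only [toList, List.getElem_ofFn, η, Equiv.apply_symm_apply]
  rw [hc, List.getD_eq_getElem _ _ h2]

end SeqNode

open FirstOrder.Language in
/-- The formula `y ≤ x`. -/
def belowFormula : Language.order.Formula (Unit ⊕ Fin 1) :=
  (leSymb (L := Language.order)).formula₂ (Term.var (Sum.inr 0)) (Term.var (Sum.inl ()))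

theorem holds_belowFormula {M : Type u} [Language.order.Structure M] (x : M) (b : Fin 1 → M) :
    Holds belowFormula x b ↔ symbLe (b 0) x := by
  unfold Holds belowFormula
  rw [Language.Formula.realize_rel₂]
  rfl

/-- Instances `y ≤ x` at finitely many nodes of a branch are satisfied by the image of the longest
one. The universe of `ω` and the two-element type `μ` stay free because `FormulaHasSOP2` and
`NamesSOP2Tree` fix them differently. -/
theorem isSOP2Tree_of_binary {M : Type u} [Language.order.Structure M] [Nonempty M]
    {g : List Bool → M} (hg : ∀ x y, x <+: y → symbLe (g x) (g y))
    (hg' : ∀ x y, ¬ x <+: y → ¬ y <+: x → ¬ ∃ w, symbLe (g x) w ∧ symbLe (g y) w)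
    {μ : Type w} (e : μ ≃ Bool) :
    IsSOP2Tree belowFormula fun (η : SeqNode (ω : Ordinal.{v}) μ) (_ : Fin 1) => g (η.toList e) := by
  classical
  refine ⟨fun η ρ h h' => ?_, fun β s hs => ?_⟩
  · simp only [holds_belowFormula]
    refine hg' _ _ ?_ ?_
    · rwa [SeqNode.toList_prefix]
    · rwa [SeqNode.toList_prefix]
  · rcases s.eq_empty_or_nonempty with rfl | hne
    · exact ⟨Classical.arbitrary M, by simp⟩
    have : Nonempty (Set.Iio (ω : Ordinal.{v})) := ⟨⟨0, Ordinal.omega0_pos⟩⟩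
    choose! α hα using fun b (hb : b ∈ s) => hs hb
    obtain ⟨m, hm, hmax⟩ := s.exists_max_image α hne
    refine ⟨g ((SeqNode.restrict β (α m)).toList e), fun b hb => ?_⟩
    rw [← hα b hb, holds_belowFormula]
    refine hg _ _ ((SeqNode.toList_prefix e _ _).2 ⟨hmax b hb, fun i => rfl⟩)

theorem binaryTree_formulaHasSOP2 : FormulaHasSOP2.{u}
    (Language.order.completeTheory (ULift.{u} (List Bool))) belowFormula := by
  intro M _ _ hM _
  have h : M ⊨ splittingTreeSentence := hM.realize_of_mem _ binaryTree_realize.{u}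
  obtain ⟨g, hg, hg'⟩ := (realize_splittingTreeSentence.1 h).exists_binary_subtree
  exact ⟨_, isSOP2Tree_of_binary hg hg' (Equiv.refl Bool)⟩

theorem symbLe_mk {I : Type u} {D : Ultrafilter I} {M : Type v} [Language.order.Structure M]
    [Nonempty M] (f g : I → M) : symbLe (Ultrapower.mk D f) (Ultrapower.mk D g) ↔
      ∀ᶠ t in (D : Filter I), symbLe (f t) (g t) := by
  have h := Ultrapower.realize_mk (D := D) (L := Language.order)
    ((Language.leSymb (L := Language.order)).formula₂ (Language.Term.var 0) (Language.Term.var 1))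
    ![f, g]
  simp only [Language.Formula.realize_rel₂] at h
  exact h

/-- For a chain of lists, the instances `F i ≤ x` form an `SOP₂`-type in the ultrapower of the
binary tree, and a realization is an upper bound. -/
theorem RealizesSOP2Types.boundsBinaryChains {I : Type u} [Infinite I] {D : Ultrafilter I}
    (h : RealizesSOP2Types BinaryShape D) : BoundsBinaryChains D := by
  classical
  intro γ hγ hγI f _ _ hf
  let F : Set.Iio γ.ord → Ultrapower D (ULift.{u} (List Bool)) := fun i =>
    Ultrapower.mk D fun t => ⟨f i t⟩
  have hFF : ∀ i j, i ≤ j → symbLe (F i) (F j) := by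
    intro i j hij
    rw [symbLe_mk]
    rcases hij.eq_or_lt with rfl | hij
    · exact Eventually.of_forall fun t => List.prefix_rfl
    · exact hf i j hij
  have htype : IsSOP2Type BinaryShape D belowFormula (Set.range fun i (_ : Fin 1) => F i) := by
    refine ⟨?_, fun _ => Set.univ, ?_, ?_⟩
    · intro s hs
      rcases s.eq_empty_or_nonempty with rfl | hne
      · exact ⟨Ultrapower.diag D ⟨[]⟩, by simp⟩
      have : Nonempty (Set.Iio γ.ord) := ⟨⟨0, hγ.ord_pos⟩⟩
      choose! α hα using fun b (hb : b ∈ s) => hs hb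
      obtain ⟨m, hm, hmax⟩ := s.exists_max_image α hne
      refine ⟨F (α m), fun b hb => ?_⟩
      rw [← hα b hb, holds_belowFormula]
      exact hFF _ _ (hmax b hb)
    · intro _
      obtain ⟨e⟩ : Nonempty (ULift.{u} Bool ≃ Bool) := ⟨Equiv.ulift⟩
      refine ⟨ω, ULift.{u} Bool, _, ⟨rfl, by simp⟩, isSOP2Tree_of_binary (g := ULift.up)
        (fun x y h => h) (fun x y h h' => ?_) e, ?_⟩
      · rintro ⟨w, h1, h2⟩
        exact (List.prefix_or_prefix_of_prefix h1 h2).elim h h'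
      · refine (Set.eq_univ_of_forall fun b => ?_).symm
        obtain ⟨η, hη⟩ := SeqNode.toList_surjective e (b 0).down
        refine ⟨η, ?_⟩
        funext k
        rw [Subsingleton.elim k 0]
        exact congrArg ULift.up hη
    · rintro _ ⟨i, rfl⟩
      exact ⟨fun _ t => ⟨f i t⟩, fun k => rfl, Eventually.of_forall fun t => trivial⟩
  obtain ⟨x, hx⟩ := h Language.order (Language.order.completeTheory (ULift.{u} (List Bool)))
    (Language.completeTheory.isComplete _ _) 1 belowFormula binaryTree_formulaHasSOP2
    (ULift.{u} (List Bool)) inferInstance (Set.range F) (by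
      have : Set.range F = Set.range (F ∘ Ordinal.ToType.mk.symm) :=
        (Ordinal.ToType.mk.symm.surjective.range_comp F).symm
      rw [this]
      refine Cardinal.mk_range_le.trans ?_
      simpa using hγI)
    (Set.range fun i _ => F i) (by rintro _ ⟨i, rfl⟩ k; exact ⟨i, rfl⟩) htype
  obtain ⟨c, rfl⟩ := Ultrapower.exists_rep x
  refine ⟨fun t => (c t).down, fun i => ?_⟩
  have := hx _ ⟨i, rfl⟩
  rw [holds_belowFormula, symbLe_mk] at this
  exact this

/-! ## Existence of saturated models -/

/-- Names for the elements of a saturated model: `node A p` names a realization of the type `p` over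
the elements named by `A`, provided that there is one. -/
inductive TypeCode (L : FirstOrder.Language.{0, 0}) (I : Type u) : Type u
  | leaf : TypeCode L I
  | node (A : I → TypeCode L I) (p : Set (L.Formula (I ⊕ Unit))) : TypeCode L I

namespace TypeCode

variable {L : FirstOrder.Language.{0, 0}} {I : Type u} {M : Type u} [L.Structure M]

/-- The assignments in which `node A p` realizes `φ` over `A`. -/
def realizeSet (M : Type u) [L.Structure M] (A : I → TypeCode L I)
    (p : Set (L.Formula (I ⊕ Unit))) (φ : L.Formula (I ⊕ Unit)) : Set (TypeCode L I → M) :=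
  {v | φ.Realize (Sum.elim (fun i => v (A i)) fun _ => v (node A p))}

/-- The assignments for which the formulas `s` over `A` are not jointly satisfiable. -/
def omitSet (M : Type u) [L.Structure M] (A : I → TypeCode L I)
    (s : Finset (L.Formula (I ⊕ Unit))) : Set (TypeCode L I → M) :=
  {v | ¬ ∃ x : M, ∀ φ ∈ s, φ.Realize (Sum.elim (fun i => v (A i)) fun _ => x)}

/-- Approximations to the ultrafilter constructed below: a set of names closed under subterms, and
a family of sets of assignments with the finite intersection property, depending on these names only
and deciding all of them. -/
structure IsApprox (w : Set (TypeCode L I) × Set (Set (TypeCode L I → M))) : Prop where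
  subterm : ∀ A p, node A p ∈ w.1 → ∀ i, A i ∈ w.1
  support : ∀ G ∈ w.2, ∀ v v' : TypeCode L I → M, (∀ c ∈ w.1, v c = v' c) → v ∈ G → v' ∈ G
  inter : ∀ t ⊆ w.2, t.Finite → (⋂₀ t).Nonempty
  decided : ∀ A p, node A p ∈ w.1 → (∀ φ ∈ p, realizeSet M A p φ ∈ w.2) ∨
    ∃ s : Finset (L.Formula (I ⊕ Unit)), ↑s ⊆ p ∧ omitSet M A s ∈ w.2

theorem IsApprox.exists_maximal [Nonempty M] :
    ∃ w : Set (TypeCode L I) × Set (Set (TypeCode L I → M)), Maximal IsApprox w := by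
  refine zorn_le₀ {w | IsApprox w} fun C hC hchain => ?_
  rcases C.eq_empty_or_nonempty with rfl | hne
  · refine ⟨(∅, ∅), ⟨by simp, by simp, fun t ht _ => ?_, by simp⟩, by simp⟩
    rw [Set.subset_empty_iff.1 ht, Set.sInter_empty]
    exact Set.univ_nonempty
  refine ⟨(⋃ w ∈ C, w.1, ⋃ w ∈ C, w.2), ⟨?_, ?_, ?_, ?_⟩, fun w hw =>
    ⟨Set.subset_biUnion_of_mem (u := fun w : Set (TypeCode L I) × Set (Set (TypeCode L I → M)) => w.1) hw,
      Set.subset_biUnion_of_mem (u := fun w : Set (TypeCode L I) × Set (Set (TypeCode L I → M)) => w.2) hw⟩⟩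
  · intro A p h i
    simp only [Set.mem_iUnion] at h ⊢
    obtain ⟨w, hw, h⟩ := h
    exact ⟨w, hw, (hC hw).subterm A p h i⟩
  · intro G hG v v' hv
    simp only [Set.mem_iUnion] at hG hv
    obtain ⟨w, hw, h⟩ := hG
    exact (hC hw).support G h v v' fun c hc => hv c ⟨w, hw, hc⟩
  · intro t ht htfin
    obtain ⟨w, hw, h⟩ : ∃ w ∈ C, t ⊆ w.2 := by
      induction t, htfin using Set.Finite.induction_on with
      | empty => exact ⟨hne.some, hne.some_mem, Set.empty_subset _⟩
      | @insert G t _ _ ih =>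
        rw [Set.insert_subset_iff] at ht
        obtain ⟨w, hw, h⟩ := ih ht.2
        have hG := ht.1
        simp only [Set.mem_iUnion] at hG
        obtain ⟨w', hw', h'⟩ := hG
        rcases hchain.total hw hw' with hle | hle
        · exact ⟨w', hw', Set.insert_subset h' (h.trans hle.2)⟩
        · exact ⟨w, hw, Set.insert_subset (hle.2 h') h⟩
    exact (hC hw).inter t h htfin
  · intro A p h
    simp only [Set.mem_iUnion] at h ⊢
    obtain ⟨w, hw, h⟩ := h
    rcases (hC hw).decided A p h with h | ⟨s, hs, h⟩
    · exact Or.inl fun φ hφ => ⟨w, hw, h φ hφ⟩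
    · exact Or.inr ⟨s, hs, w, hw, h⟩

/-- An approximation can be extended by a name all of whose subterms it contains, along with sets of
assignments that decide it. -/
theorem IsApprox.extend {w : Set (TypeCode L I) × Set (Set (TypeCode L I → M))} (hw : IsApprox w)
    {A : I → TypeCode L I} {p : Set (L.Formula (I ⊕ Unit))} (hA : ∀ i, A i ∈ w.1)
    {𝒮 : Set (Set (TypeCode L I → M))}
    (hsupp : ∀ G ∈ 𝒮, ∀ v v' : TypeCode L I → M, (∀ i, v (A i) = v' (A i)) →
      v (node A p) = v' (node A p) → v ∈ G → v' ∈ G)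
    (hinter : ∀ t ⊆ w.2 ∪ 𝒮, t.Finite → (⋂₀ t).Nonempty)
    (hdec : (∀ φ ∈ p, realizeSet M A p φ ∈ 𝒮) ∨
      ∃ s : Finset (L.Formula (I ⊕ Unit)), ↑s ⊆ p ∧ omitSet M A s ∈ 𝒮) :
    IsApprox (insert (node A p) w.1, w.2 ∪ 𝒮) := by
  refine ⟨?_, ?_, hinter, ?_⟩
  · rintro A' p' (h | h) i
    · obtain ⟨rfl, rfl⟩ := TypeCode.node.inj h
      exact Or.inr (hA i)
    · exact Or.inr (hw.subterm _ _ h i)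
  · rintro G (hG | hG) v v' h
    · exact hw.support G hG v v' fun c hc => h c (Or.inr hc)
    · exact hsupp G hG v v' (fun i => h _ (Or.inr (hA i))) (h _ (Or.inl rfl))
  · rintro A' p' (h | h)
    · obtain ⟨rfl, rfl⟩ := TypeCode.node.inj h
      rcases hdec with h | ⟨s, hs, h⟩
      · exact Or.inl fun φ hφ => Or.inr (h φ hφ)
      · exact Or.inr ⟨s, hs, Or.inr h⟩
    · rcases hw.decided A' p' h with h | ⟨s, hs, h⟩
      · exact Or.inl fun φ hφ => Or.inl (h φ hφ)
      · exact Or.inr ⟨s, hs, Or.inl h⟩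

/-- By induction on names: if all subterms of `node A p` are present, either the sets saying that it
realizes `p` can be added, or a set saying that a finite part of `p` is unsatisfiable can. -/
theorem IsApprox.mem_of_maximal {w : Set (TypeCode L I) × Set (Set (TypeCode L I → M))}
    (hw : Maximal IsApprox w) (c : TypeCode L I) : c ∈ w.1 := by
  classical
  induction c with
  | leaf =>
    have h : IsApprox (insert leaf w.1, w.2) := by
      refine ⟨?_, ?_, hw.1.inter, ?_⟩
      · rintro A p (h | h) i
        · cases h
        · exact Or.inr (hw.1.subterm A p h i)
      · exact fun G hG v v' h => hw.1.support G hG v v' fun c hc => h c (Or.inr hc)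
      · rintro A p (h | h)
        · cases h
        · exact hw.1.decided A p h
    exact (hw.2 h ⟨Set.subset_insert _ _, le_rfl⟩).1 (Or.inl rfl)
  | node A p hA =>
    by_contra hc
    have hmax : ∀ 𝒮, ¬ IsApprox (insert (node A p) w.1, w.2 ∪ 𝒮) := fun 𝒮 h =>
      hc ((hw.2 h ⟨Set.subset_insert _ _, Set.subset_union_left⟩).1 (Or.inl rfl))
    by_cases hO : ∀ t ⊆ w.2 ∪ realizeSet M A p '' p, t.Finite → (⋂₀ t).Nonempty
    · refine hmax _ (hw.1.extend hA ?_ hO (Or.inl fun φ hφ => Set.mem_image_of_mem _ hφ))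
      rintro _ ⟨φ, _, rfl⟩ v v' h1 h2 hv
      simp only [realizeSet, Set.mem_ofPred_eq] at hv ⊢
      simpa only [h1, h2] using hv
    · push Not at hO
      obtain ⟨t, ht, htfin, hte⟩ := hO
      obtain ⟨s, hsp, hst⟩ : ∃ s : Finset (L.Formula (I ⊕ Unit)), ↑s ⊆ p ∧
          ∀ G ∈ t, G ∈ w.2 ∨ ∃ φ ∈ s, G = realizeSet M A p φ := by
        have : ∀ G ∈ t, ∃ s : Finset (L.Formula (I ⊕ Unit)), ↑s ⊆ p ∧
            (G ∈ w.2 ∨ ∃ φ ∈ s, G = realizeSet M A p φ) := by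
          intro G hG
          rcases ht hG with h | ⟨φ, hφ, rfl⟩
          · exact ⟨∅, by simp, Or.inl h⟩
          · exact ⟨{φ}, by simpa using hφ, Or.inr ⟨φ, by simp, rfl⟩⟩
        choose! s hs hs' using this
        refine ⟨htfin.toFinset.biUnion s, ?_, fun G hG => (hs' G hG).imp id ?_⟩
        · intro φ hφ
          simp only [Finset.coe_biUnion, Set.mem_iUnion] at hφ
          obtain ⟨G, hG, hφ⟩ := hφ
          exact hs G (by simpa using hG) hφ
        · rintro ⟨φ, hφ, h⟩
          exact ⟨φ, Finset.mem_biUnion.2 ⟨G, by simpa using hG, hφ⟩, h⟩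
      -- The value at the new name is free, since the sets in `w.2` do not depend on it. Resetting
      -- it to a solution `x` of `s` would give a point of the empty intersection `⋂₀ t`.
      have homit : ∀ v : TypeCode L I → M, (∀ G ∈ t, G ∈ w.2 → v ∈ G) → v ∈ omitSet M A s := by
        rintro v hv ⟨x, hx⟩
        have hne : ∀ i, A i ≠ node A p := fun i h => hc (h ▸ hA i)
        have hmem : Function.update v (node A p) x ∈ ⋂₀ t := by
          intro G hG
          rcases hst G hG with h | ⟨φ, hφ, rfl⟩
          · refine hw.1.support G h v _ (fun c hcw => ?_) (hv G hG h)
            rw [Function.update_of_ne]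
            rintro rfl
            exact hc hcw
          · simp only [realizeSet, Set.mem_ofPred_eq, Function.update_self,
              Function.update_of_ne (hne _)]
            exact hx φ hφ
        rw [hte] at hmem
        exact hmem
      refine hmax {omitSet M A s} (hw.1.extend hA ?_ ?_ (Or.inr ⟨s, hsp, rfl⟩))
      · rintro _ rfl v v' h1 _ hv
        simp only [omitSet, Set.mem_ofPred_eq] at hv ⊢
        simpa only [h1] using hv
      · intro t' ht' ht'fin
        obtain ⟨v, hv⟩ := hw.1.inter ((t' ∪ t) ∩ w.2) Set.inter_subset_right
          ((ht'fin.union htfin).inter_of_left _)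
        refine ⟨v, fun G hG => ?_⟩
        rcases ht' hG with h | rfl
        · exact hv G ⟨Or.inl hG, h⟩
        · exact homit v fun G hG h => hv G ⟨Or.inr hG, h⟩

/-- There is an ultrafilter on the assignments that decides all names. -/
theorem exists_ultrafilter [Nonempty M] : ∃ 𝒰 : Ultrafilter (TypeCode L I → M), ∀ A p,
    (∀ φ ∈ p, realizeSet M A p φ ∈ 𝒰) ∨
      ∃ s : Finset (L.Formula (I ⊕ Unit)), ↑s ⊆ p ∧ omitSet M A s ∈ 𝒰 := by
  obtain ⟨w, hw⟩ := IsApprox.exists_maximal (L := L) (I := I) (M := M)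
  have : (generate w.2).NeBot := generate_neBot_iff.2 hw.1.inter
  have hmem : ∀ G ∈ w.2, G ∈ Ultrafilter.of (generate w.2) := fun G hG =>
    Ultrafilter.of_le _ (mem_generate_of_mem hG)
  refine ⟨Ultrafilter.of (generate w.2), fun A p => ?_⟩
  rcases hw.1.decided A p (IsApprox.mem_of_maximal hw _) with h | ⟨s, hs, h⟩
  · exact Or.inl fun φ hφ => hmem _ (h φ hφ)
  · exact Or.inr ⟨s, hs, hmem _ h⟩

/-- The element named by `c` in the ultrapower of `M` by an ultrafilter on the assignments. -/
def elem (𝒰 : Ultrafilter (TypeCode L I → M)) (c : TypeCode L I) : Ultrapower 𝒰 M :=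
  Ultrapower.mk 𝒰 fun v => v c

/-- By Łoś, finite satisfiability in the ultrapower rules out that the ultrafilter omits a finite
part of `p`, so the name attached to `p` realizes it. -/
theorem exists_realization [Nonempty M] {𝒰 : Ultrafilter (TypeCode L I → M)}
    (h𝒰 : ∀ A p, (∀ φ ∈ p, realizeSet M A p φ ∈ 𝒰) ∨
      ∃ s : Finset (L.Formula (I ⊕ Unit)), ↑s ⊆ p ∧ omitSet M A s ∈ 𝒰)
    {β : Type*} (e : β ↪ I) (x : β → TypeCode L I) (p : Set (L.Formula (β ⊕ Unit)))
    (hp : ∀ s : Finset (L.Formula (β ⊕ Unit)), ↑s ⊆ p → ∃ y : Ultrapower 𝒰 M, ∀ φ ∈ s,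
      φ.Realize (Sum.elim (fun b => elem 𝒰 (x b)) fun _ => y)) :
    ∃ c, ∀ φ ∈ p, φ.Realize (Sum.elim (fun b => elem 𝒰 (x b)) fun _ => elem 𝒰 c) := by
  classical
  -- Names have arity `I`: the parameters are placed along `e`, and the unused places are filled
  -- with `leaf`.
  let A : I → TypeCode L I := Function.extend e x fun _ => leaf
  have hA : ∀ b, A (e b) = x b := fun b => e.injective.extend_apply _ _ _
  let ρ : L.Formula (β ⊕ Unit) → L.Formula (I ⊕ Unit) := fun φ => φ.relabel (Sum.map e id)
  have hρ : ∀ φ (v : TypeCode L I → M) (y : M),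
      (ρ φ).Realize (Sum.elim (fun i => v (A i)) fun _ => y) ↔
        φ.Realize (Sum.elim (fun b => v (x b)) fun _ => y) := by
    intro φ v y
    rw [Language.Formula.realize_relabel]
    congr! 1
    ext i
    rcases i with b | i
    · simp [hA]
    · rfl
  have hlos : ∀ (φ : L.Formula (β ⊕ Unit)) (g : (TypeCode L I → M) → M),
      φ.Realize (Sum.elim (fun b => elem 𝒰 (x b)) fun _ => Ultrapower.mk 𝒰 g) ↔
        ∀ᶠ v in (𝒰 : Filter _), φ.Realize (Sum.elim (fun b => v (x b)) fun _ => g v) := by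
    intro φ g
    convert! Ultrapower.realize_mk φ (Sum.elim (fun b v => v (x b)) fun _ => g) using 2
    · ext i; cases i <;> rfl
    · ext v; congr! 1; ext i; cases i <;> rfl
  rcases h𝒰 A (ρ '' p) with h | ⟨s, hs, h⟩
  · refine ⟨node A (ρ '' p), fun φ hφ => (hlos φ _).2 ?_⟩
    filter_upwards [h _ (Set.mem_image_of_mem ρ hφ)] with v hv
    exact (hρ φ v _).1 hv
  · obtain ⟨s', hs', rfl⟩ := Finset.subset_set_image_iff.1 hs
    obtain ⟨y, hy⟩ := hp s' hs'
    obtain ⟨g, rfl⟩ := Ultrapower.exists_rep y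
    have h' : ∀ᶠ v in (𝒰 : Filter _), ∀ φ ∈ s',
        φ.Realize (Sum.elim (fun b => v (x b)) fun _ => g v) :=
      (Filter.eventually_all_finset s').2 fun φ hφ => (hlos φ g).1 (hy φ hφ)
    obtain ⟨v, hv, hv'⟩ := (h'.and h).exists
    refine absurd ⟨g v, fun φ hφ => ?_⟩ hv'
    obtain ⟨φ, hφ', rfl⟩ := Finset.mem_image.1 hφ
    exact (hρ φ v _).2 (hv φ hφ')

end TypeCode

open FirstOrder.Language in
/-- Every structure is elementarily equivalent to a `|I|⁺`-saturated one. -/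
theorem exists_saturated (L : FirstOrder.Language.{0, 0}) (M : Type u) [L.Structure M] [Nonempty M]
    (I : Type u) [Infinite I] : ∃ (N : Type u) (_ : L.Structure N) (_ : Nonempty N),
      (N ≅[L] M) ∧ IsSaturated L N (Order.succ #I) := by
  classical
  obtain ⟨𝒰, h𝒰⟩ := TypeCode.exists_ultrafilter (L := L) (I := I) (M := M)
  -- Applied to one formula, realization by names gives named witnesses. This closes the named
  -- elements under functions and is the Tarski–Vaught criterion for them.
  have key : ∀ {n : ℕ} (x : Fin n → TypeCode L I) (φ : L.Formula (Fin n ⊕ Unit))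
      (y : Ultrapower 𝒰 M), φ.Realize (Sum.elim (fun b => TypeCode.elem 𝒰 (x b)) fun _ => y) →
      ∃ c, φ.Realize (Sum.elim (fun b => TypeCode.elem 𝒰 (x b)) fun _ => TypeCode.elem 𝒰 c) := by
    intro n x φ y hy
    obtain ⟨c, hc⟩ := TypeCode.exists_realization h𝒰
      (Fin.valEmbedding.trans (Infinite.natEmbedding I)) x {φ} (fun s hs => ⟨y, fun φ' hφ' => by
        rw [Set.mem_singleton_iff.1 (hs hφ')]; exact hy⟩)
    exact ⟨c, hc φ rfl⟩
  let S : L.Substructure (Ultrapower 𝒰 M) :=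
    { carrier := Set.range (TypeCode.elem 𝒰)
      fun_mem := by
        intro n f x hx
        choose c hc using hx
        obtain ⟨d, hd⟩ := key c ((Term.func f fun i => Term.var (Sum.inl i)).equal
          (Term.var (Sum.inr ()))) (Structure.funMap f x) (by
            rw [Formula.realize_equal]
            simp [hc])
        rw [Formula.realize_equal] at hd
        simp only [Term.realize_func, Term.realize_var, Sum.elim_inl, Sum.elim_inr, hc] at hd
        exact ⟨d, hd.symm⟩ }
  have hS : S.IsElementary := by
    refine S.isElementary_of_exists fun n φ x a hφ => ?_
    choose c hc using fun i => (x i).2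
    have hconv : ∀ y : Ultrapower 𝒰 M,
        (φ.toFormula.relabel (Sum.elim Empty.elim
          (Fin.lastCases (Sum.inr ()) Sum.inl : Fin (n + 1) → Fin n ⊕ Unit))).Realize
          (Sum.elim (fun b => TypeCode.elem 𝒰 (c b)) fun _ => y) ↔
        φ.Realize default (Fin.snoc (fun i => (x i : Ultrapower 𝒰 M)) y) := by
      intro y
      rw [Formula.realize_relabel, BoundedFormula.realize_toFormula]
      congr! 1
      ext i
      refine Fin.lastCases ?_ (fun i => ?_) i
      · simp
      · simp [hc]
    obtain ⟨d, hd⟩ := key c _ a ((hconv a).2 hφ)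
    exact ⟨⟨_, d, rfl⟩, (hconv _).1 hd⟩
  let N : L.ElementarySubstructure (Ultrapower 𝒰 M) := ⟨S, hS⟩
  refine ⟨N, inferInstance, inferInstance, N.elementarilyEquivalent.trans ?_, ?_⟩
  · rw [elementarilyEquivalent_iff]
    intro φ
    rw [Ultraproduct.sentence_realize]
    exact eventually_const
  · intro A hA p hp
    obtain ⟨e⟩ := (Cardinal.le_def A I).1 (Order.lt_succ_iff.1 hA)
    choose c hc using fun a : A => a.1.2
    have hconv : ∀ (φ : L.Formula (A ⊕ Unit)) (y : N),
        φ.Realize (Sum.elim (fun a => TypeCode.elem 𝒰 (c a)) fun _ => (y : Ultrapower 𝒰 M)) ↔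
          φ.Realize (Sum.elim (fun a : A => (a : N)) fun _ => y) := by
      intro φ y
      rw [← N.subtype.map_formula]
      congr! 1
      ext i
      rcases i with a | i
      · exact hc a
      · rfl
    obtain ⟨d, hd⟩ := TypeCode.exists_realization h𝒰 e c p (fun s hs => by
      obtain ⟨y, hy⟩ := hp s hs
      exact ⟨y, fun φ hφ => (hconv φ y).2 (hy φ hφ)⟩)
    exact ⟨⟨_, d, rfl⟩, fun φ hφ => (hconv φ ⟨_, d, rfl⟩).1 (hd φ hφ)⟩

/-! ## Treetops and binary sequences -/

open FirstOrder.Language in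
/-- The interpretation of the order of a structure by its order symbol. -/
def selfInterp : OrderInterp Language.order where
  npar := 0
  dim := 1
  dom := ⊤
  eqv := (leSymb (L := Language.order)).formula₂ (Term.var (Sum.inr (Sum.inl 0)))
      (Term.var (Sum.inr (Sum.inr 0))) ⊓
    (leSymb (L := Language.order)).formula₂ (Term.var (Sum.inr (Sum.inr 0)))
      (Term.var (Sum.inr (Sum.inl 0)))
  le := (leSymb (L := Language.order)).formula₂ (Term.var (Sum.inr (Sum.inl 0)))
      (Term.var (Sum.inr (Sum.inr 0)))

section

variable {M : Type u} [Language.order.Structure M] (c : Fin selfInterp.npar → M)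
  (x y : Fin selfInterp.dim → M)

theorem selfInterp_dom : selfInterp.Dom c x := by
  unfold OrderInterp.Dom selfInterp
  exact Language.BoundedFormula.realize_top.2 trivial

theorem selfInterp_le : selfInterp.Le c x y ↔ symbLe (x (0 : Fin 1)) (y (0 : Fin 1)) := by
  unfold OrderInterp.Le selfInterp
  simp only [Language.Formula.realize_rel₂]
  rfl

theorem selfInterp_eqv : selfInterp.Eqv c x y ↔ selfInterp.Le c x y ∧ selfInterp.Le c y x := by
  rw [selfInterp_le, selfInterp_le]
  unfold OrderInterp.Eqv selfInterp
  simp only [Language.Formula.realize_inf, Language.Formula.realize_rel₂]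
  rfl

variable {c} in
theorem IsSplittingTree.isTree (h : IsSplittingTree fun x y : M => symbLe x y) :
    selfInterp.IsTree c where
  refl x _ := (selfInterp_le c x x).2 (h.refl _)
  trans x y z _ _ _ := by
    simp only [selfInterp_le]
    exact h.trans _ _ _
  eqv_iff x y _ _ := selfInterp_eqv c x y
  linear x y z _ _ _ := by
    simp only [selfInterp_le]
    exact h.linear _ _ _

end

/-- The chain is sent by a copy `g` of the binary tree into a saturated model, bounded there, and
the bound is pulled back to lists at each index. -/
theorem HasTreetops.boundsBinaryChains {I : Type u} [Infinite I] {D : Ultrafilter I}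
    (hD : HasTreetops D (Order.succ #I)) : BoundsBinaryChains D := by
  classical
  intro γ hγ hγI f h hlen hf
  obtain ⟨M, _, _, hM, hsat⟩ := exists_saturated Language.order (ULift.{u} (List Bool)) I
  have hsplit : IsSplittingTree fun x y : M => symbLe x y :=
    realize_splittingTreeSentence.1 ((hM.realize_sentence _).2 binaryTree_realize)
  obtain ⟨g, hg, hg'⟩ := hsplit.exists_binary_subtree
  have hgg : ∀ i j, i < j → symbLe (Ultrapower.mk D fun t => g (f i t))
      (Ultrapower.mk D fun t => g (f j t)) := by
    intro i j hij
    rw [symbLe_mk]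
    exact (hf i j hij).mono fun t => hg _ _
  have : Countable Language.order.Symbols := inferInstance
  obtain ⟨b, -, hb⟩ := hD.2 Language.order M hsat selfInterp (fun k => Fin.elim0 k) hsplit.isTree γ hγ
    (Order.lt_succ_iff.2 hγI) (fun i _ => Ultrapower.mk D fun t => g (f i t))
    (fun i => selfInterp_dom _ _) (fun i j hij => (selfInterp_le _ _ _).2 (hgg i j hij))
  obtain ⟨b', hb'⟩ := Ultrapower.exists_rep (b (0 : Fin 1))
  -- The element `b' t` need not be in the range of `g` and may lie above an infinite branch. Below
  -- height `h t` only finitely many lists map below it; they are pairwise comparable, and the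
  -- longest is `m`.
  have hex : ∀ t, ∃ m : List Bool, ∀ x : List Bool, x.length ≤ h t → symbLe (g x) (b' t) → x <+: m := by
    intro t
    let S : Set (List Bool) := {x | x.length ≤ h t ∧ symbLe (g x) (b' t)}
    have hS : S.Finite := (List.finite_length_le Bool (h t)).subset fun x hx => hx.1
    rcases S.eq_empty_or_nonempty with hS0 | hne
    · exact ⟨[], fun x h1 h2 => absurd (show x ∈ S from ⟨h1, h2⟩) (by simp [hS0])⟩
    · obtain ⟨m, hm, hmax⟩ := Set.exists_max_image S List.length hS hne
      refine ⟨m, fun x h1 h2 => ?_⟩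
      by_contra hxm
      refine hg' x m hxm (fun hmx => hxm ?_) ⟨b' t, h2, hm.2⟩
      rw [hmx.eq_of_length (le_antisymm hmx.length_le (hmax x ⟨h1, h2⟩))]
  choose m hm using hex
  refine ⟨m, fun i => ?_⟩
  have hi := (selfInterp_le _ _ _).1 (hb i)
  rw [← hb', symbLe_mk] at hi
  filter_upwards [hi, hlen i] with t h1 h2 using hm t _ h2 h1

theorem mainTheorem6 {I : Type u} [Infinite I] (D : Ultrafilter I) (hD : D.IsRegular) :
    List.TFAE [
      HasTreetops D (Order.succ #I),
      ∀ κ : Cardinal.{u}, (κ, κ) ∉ cutSpectrum D,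
      RealizesSOP2Types BinaryShape D,
      RealizesSOP2Types AnyShape D] := by
  tfae_have 1 → 2 := fun h => h.boundsBinaryChains.no_symmetric_cut
  tfae_have 2 → 1 := hasTreetops_of_no_symmetric_cut hD
  tfae_have 2 → 4 := realizesSOP2Types_of_no_symmetric_cut hD
  tfae_have 4 → 3 := RealizesSOP2Types.mono fun _ _ _ => trivial
  tfae_have 3 → 2 := fun h => h.boundsBinaryChains.no_symmetric_cut
  tfae_finish
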